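/- For a finite graph $G$ and a set $S\subseteq V(G)$ let $N(S)=\{v\in V(G)\setminus S:\ v \text{ is adjacent to some } u\in S\}$, and for $p\in[0,1]$ let $G_p$ be the random subgraph of $G$ on the vertex set $V(G)$ obtained by retaining each edge of $G$ independently with probability $p$. There is an absolute constant $C>0$ such that for every $c\in(0,1)$ there is $\varepsilon_0=\varepsilon_0(c)>0$ such that for every $\varepsilon\in(0,\varepsilon_0]$ there is $\gamma=\gamma(\varepsilon,c)>0$ with the following property. Let $d\ge 1$ be an integer with $p:=\frac{1+\varepsilon}{d}\le 1$, let $G$ be a graph on $n$ vertices, and let $k\ge 1$ be an integer equal to $cn/d$ rounded up or down, i.e. $\left|k-\frac{cn}{d}\right|<1$. If every $S\subseteq V(G)$ with $|S|=k$ satisfies $|N(S)|\ge d|S|$, then $$\mathbb P\bigl(G_p\text{ contains a cycle of length at least } C\varepsilon^2c^2n\bigr)\ \ge\ 1-e^{-\gamma n}.$$ -/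

import Mathlib

open MeasureTheory ProbabilityTheory unitInterval

namespace Percolation

/-- The external neighbourhood `N(S)`: the vertices outside `S` with a neighbour in `S`. -/
noncomputable def extNbhd {V : Type*} [Fintype V] (G : SimpleGraph V) (S : Finset V) : Finset V :=
  open Classical in Finset.univ.filter fun v => v ∉ S ∧ ∃ u ∈ S, G.Adj u v

/-- `G` is a `(k, d)`-expander: every set `S` of exactly `k` vertices has `|N(S)| ≥ d |S|`. -/
def IsExpanderAt {V : Type*} [Fintype V] (G : SimpleGraph V) (k d : ℕ) : Prop :=
  ∀ S : Finset V, S.card = k → d * S.card ≤ (extNbhd G S).card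

/-- The law of the random subgraph `G_p` of `G`: every edge of `G` is retained independently with
probability `p`, and all vertices are kept. -/
noncomputable def randomSubgraph {V : Type*} (G : SimpleGraph V) (p : I) :
    Measure (SimpleGraph V) :=
  (setBernoulli G.edgeSet p).map SimpleGraph.fromEdgeSet

/-- `H` contains a cycle with at least `L` vertices (equivalently, edges). -/
def HasCycleOfLengthAtLeast {V : Type*} (H : SimpleGraph V) (L : ℝ) : Prop :=
  ∃ (v : V) (w : H.Walk v v), w.IsCycle ∧ L ≤ (w.length : ℝ)

end Percolation

/-!
Let `φ` be a function on `[0, k]` that grows ever more steeply towards `k`. A set `X` that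
minimises `|N(X)| - φ |X|` among the sets of at most `k` vertices has fewer than `k` of them, and
every set of at most `r = k - |X|` vertices outside `X` expands in `V ∖ X` by a factor `D`, which
is larger the smaller `r` is; here `r` is at least of order `ε ^ 2 k`, and `D` at least
`(1 - 3 ε / 8) d`.

Explore `V ∖ X` by depth first search in `G_{p₁}`, where `p₁ = (1 + 3 ε / 4) / d`. By a Chernoff
bound, no window of the search has too few positive answers for the number of its questions.
Consider the length of the stack as a function of the number of discovered vertices, at the first
time at which this function is flat, that is, has not grown much while the last few vertices were
discovered. As `p₁ D > 1`, the vertices processed in that period cannot have all the edges that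
expansion gives them going to unseen vertices: these would be too many to be answered negatively.
So many of them go to vertices discovered earlier, and the ends of such an edge are connected by a
path of length at least `κ`, of order `ε ^ 2 d k`, in `G_{p₁}`. Hence there are more than `κ / p₁`
edges of `G` whose ends are so connected, and a second round of exposure, with a small retention
probability, keeps one of them and closes a long cycle. All exceptional probabilities are
exponentially small in `n`. If `n` is bounded, then the expander `G` itself contains a long cycle
and survives percolation with probability bounded below.
-/

namespace Percolation

open SimpleGraph (fromEdgeSet)

section RandomSubset

variable {α : Type*} {E : Finset α} {p : ℝ}

/-- The expectation of `f F`, where `F` is a random subset of `E` that contains each element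
independently with probability `p`. A finite sum spares all measurability considerations. -/
noncomputable def expect (E : Finset α) (p : ℝ) (f : Finset α → ℝ) : ℝ :=
  ∑ F ∈ E.powerset, p ^ F.card * (1 - p) ^ (E.card - F.card) * f F

open Classical in
/-- The probability of the event `A`, for the random subset of `E` described at `expect`. -/
noncomputable def prob (E : Finset α) (p : ℝ) (A : Finset α → Prop) : ℝ :=
  expect E p fun F => if A F then 1 else 0

lemma expect_empty (p : ℝ) (f : Finset α → ℝ) : expect ∅ p f = f ∅ := by
  simp [expect]

lemma expect_insert [DecidableEq α] {a : α} (ha : a ∉ E) (p : ℝ) (f : Finset α → ℝ) :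
    expect (insert a E) p f =
      p * expect E p (fun F => f (insert a F)) + (1 - p) * expect E p f := by
  unfold expect
  rw [Finset.sum_powerset_insert ha, add_comm, Finset.mul_sum, Finset.mul_sum]
  congr 1 <;> refine Finset.sum_congr rfl fun F hF => ?_
  · have haF : a ∉ F := fun h => ha (Finset.mem_powerset.1 hF h)
    rw [Finset.card_insert_of_notMem ha, Finset.card_insert_of_notMem haF,
      Nat.add_sub_add_right]
    ring
  · have hcard := Finset.card_le_card (Finset.mem_powerset.1 hF)
    rw [Finset.card_insert_of_notMem ha, Nat.sub_add_comm hcard]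
    ring

lemma expect_congr {f g : Finset α → ℝ} (h : ∀ F ⊆ E, f F = g F) :
    expect E p f = expect E p g :=
  Finset.sum_congr rfl fun F hF => by rw [h F (Finset.mem_powerset.1 hF)]

lemma expect_add (E : Finset α) (p : ℝ) (f g : Finset α → ℝ) :
    expect E p (fun F => f F + g F) = expect E p f + expect E p g := by
  simp only [expect, mul_add, Finset.sum_add_distrib]

lemma expect_const_mul (E : Finset α) (p c : ℝ) (f : Finset α → ℝ) :
    expect E p (fun F => c * f F) = c * expect E p f := by
  simp only [expect, Finset.mul_sum]
  exact Finset.sum_congr rfl fun F _ => by ring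

lemma expect_sum {ι : Type*} (s : Finset ι) (E : Finset α) (p : ℝ) (f : ι → Finset α → ℝ) :
    expect E p (fun F => ∑ i ∈ s, f i F) = ∑ i ∈ s, expect E p (f i) := by
  simp only [expect, Finset.mul_sum]
  exact Finset.sum_comm

lemma expect_const (E : Finset α) (p c : ℝ) : expect E p (fun _ => c) = c := by
  classical
  induction E using Finset.induction_on with
  | empty => rw [expect_empty]
  | insert a E ha ih => rw [expect_insert ha, ih]; ring

lemma expect_mono (hp0 : 0 ≤ p) (hp1 : p ≤ 1) {f g : Finset α → ℝ} (h : ∀ F ⊆ E, f F ≤ g F) :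
    expect E p f ≤ expect E p g :=
  Finset.sum_le_sum fun F hF => mul_le_mul_of_nonneg_left (h F (Finset.mem_powerset.1 hF))
    (mul_nonneg (pow_nonneg hp0 _) (pow_nonneg (sub_nonneg.2 hp1) _))

lemma expect_union [DecidableEq α] (E : Finset α) {p₁ p₂ : ℝ}
    (hp : 1 - p = (1 - p₁) * (1 - p₂)) (f : Finset α → ℝ) :
    expect E p f = expect E p₁ fun F₁ => expect E p₂ fun F₂ => f (F₁ ∪ F₂) := by
  induction E using Finset.induction_on generalizing f with
  | empty => simp only [expect_empty, Finset.empty_union]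
  | insert a E ha ih =>
    simp only [expect_insert ha, expect_add, expect_const_mul, Finset.insert_union,
      Finset.union_insert, Finset.insert_idem]
    rw [ih, ih, show p = 1 - (1 - p₁) * (1 - p₂) by linarith]
    ring

lemma expect_ite_mem_mul [DecidableEq α] {e : α} (he : e ∈ E) (p a b : ℝ) {g : Finset α → ℝ}
    (hg : ∀ F, g (insert e F) = g F) :
    expect E p (fun F => (if e ∈ F then a else b) * g F) =
      (p * a + (1 - p) * b) * expect E p g := by
  obtain ⟨E, heE, rfl⟩ : ∃ E', e ∉ E' ∧ insert e E' = E :=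
    ⟨E.erase e, Finset.notMem_erase e E, Finset.insert_erase he⟩
  have hmiss : expect E p (fun F => (if e ∈ F then a else b) * g F) = b * expect E p g := by
    rw [← expect_const_mul]
    exact expect_congr fun F hF => by rw [if_neg fun h => heE (hF h)]
  rw [expect_insert heE, expect_insert heE, hmiss]
  simp only [hg, Finset.mem_insert_self, if_true, expect_const_mul]
  ring

lemma prob_insert [DecidableEq α] {a : α} (ha : a ∉ E) (p : ℝ) (A : Finset α → Prop) :
    prob (insert a E) p A = p * prob E p (fun F => A (insert a F)) + (1 - p) * prob E p A :=
  expect_insert ha p _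

lemma prob_congr {A B : Finset α → Prop} (h : ∀ F ⊆ E, (A F ↔ B F)) :
    prob E p A = prob E p B :=
  expect_congr fun F hF => by classical exact if_congr (h F hF) rfl rfl

lemma prob_mono (hp0 : 0 ≤ p) (hp1 : p ≤ 1) {A B : Finset α → Prop} (h : ∀ F ⊆ E, A F → B F) :
    prob E p A ≤ prob E p B := by
  refine expect_mono hp0 hp1 fun F hF => ?_
  by_cases hA : A F
  · rw [if_pos hA, if_pos (h F hF hA)]
  · rw [if_neg hA]
    positivity

lemma mul_prob_le_expect (hp0 : 0 ≤ p) (hp1 : p ≤ 1) {A : Finset α → Prop} {f : Finset α → ℝ}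
    {a : ℝ} (hf : ∀ F, 0 ≤ f F) (hA : ∀ F, A F → a ≤ f F) : a * prob E p A ≤ expect E p f := by
  rw [prob, ← expect_const_mul]
  refine expect_mono hp0 hp1 fun F _ => ?_
  split_ifs with h
  · rw [mul_one]
    exact hA F h
  · rw [mul_zero]
    exact hf F

lemma prob_le_one (hp0 : 0 ≤ p) (hp1 : p ≤ 1) (A : Finset α → Prop) : prob E p A ≤ 1 := by
  rw [← expect_const E p 1]
  exact expect_mono hp0 hp1 fun F _ => by split_ifs <;> norm_num

lemma prob_not (E : Finset α) (p : ℝ) (A : Finset α → Prop) :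
    prob E p (fun F => ¬ A F) = 1 - prob E p A := by
  rw [eq_sub_iff_add_eq, prob, prob, ← expect_add]
  refine (expect_congr fun F _ => ?_).trans (expect_const E p 1)
  by_cases hA : A F <;> simp [hA]

lemma prob_exists_le {ι : Type*} (hp0 : 0 ≤ p) (hp1 : p ≤ 1) (s : Finset ι)
    (A : ι → Finset α → Prop) :
    prob E p (fun F => ∃ i ∈ s, A i F) ≤ ∑ i ∈ s, prob E p (A i) := by
  classical
  simp only [prob, ← expect_sum]
  refine expect_mono hp0 hp1 fun F _ => ?_
  have hnonneg : ∀ i ∈ s, (0 : ℝ) ≤ if A i F then 1 else 0 := fun _ _ => by positivity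
  split_ifs with h
  · obtain ⟨i, hi, hA⟩ := h
    refine le_trans ?_ (Finset.single_le_sum hnonneg hi)
    rw [if_pos hA]
  · exact Finset.sum_nonneg hnonneg

lemma prob_disjoint {A : Finset α} (hA : A ⊆ E) (p : ℝ) :
    prob E p (fun F => Disjoint F A) = (1 - p) ^ A.card := by
  classical
  induction E using Finset.induction_on generalizing A with
  | empty => simp [Finset.subset_empty.1 hA, prob, expect_empty]
  | insert a E ha ih =>
    rw [prob_insert ha]
    by_cases haA : a ∈ A
    · have hmem : prob E p (fun F => Disjoint (insert a F) A) = 0 := by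
        simp [prob, Finset.disjoint_insert_left, haA, expect_const]
      have herase : prob E p (fun F => Disjoint F A) = prob E p fun F => Disjoint F (A.erase a) :=
        prob_congr fun F hF => by
          rw [← Finset.disjoint_erase_comm, Finset.erase_eq_of_notMem fun h => ha (hF h)]
      rw [hmem, herase, ih (Finset.subset_insert_iff.1 hA), ← Finset.card_erase_add_one haA]
      ring
    · simp only [Finset.disjoint_insert_left, haA, not_false_iff, true_and]
      rw [ih ((Finset.subset_insert_iff_of_notMem haA).1 hA)]
      ring

lemma pow_card_le_prob (hp0 : 0 ≤ p) (hp1 : p ≤ 1) {A : Finset α → Prop} (hA : A E) :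
    p ^ E.card ≤ prob E p A := by
  classical
  have hnonneg : ∀ F ∈ E.powerset,
      0 ≤ p ^ F.card * (1 - p) ^ (E.card - F.card) * if A F then 1 else 0 := fun F _ =>
    mul_nonneg (mul_nonneg (pow_nonneg hp0 _) (pow_nonneg (sub_nonneg.2 hp1) _)) (by positivity)
  simpa [hA, prob, expect] using Finset.single_le_sum hnonneg (Finset.mem_powerset_self E)

end RandomSubset

section Law

variable {V : Type*} [Finite V]

lemma measurableSet_of_finite (A : Set (SimpleGraph V)) : MeasurableSet A := by
  have hfin : (SimpleGraph.edgeSet '' A).Finite := Set.toFinite _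
  have hpre := SimpleGraph.measurable_edgeSet (V := V) hfin.measurableSet
  rwa [Set.preimage_image_eq _ SimpleGraph.edgeSet_injective] at hpre

lemma setBernoulli_real_eq_prob {α : Type*} [Finite α] (E : Finset α) (p : I)
    {A : Set (Set α)} :
    (setBernoulli (E : Set α) p).real A = prob E p fun F => (F : Set α) ∈ A := by
  classical
  have hfibre : {s | s ∈ A ∧ s ⊆ (E : Set α)} =
      ⋃ F ∈ E.powerset.filter fun F : Finset α => (F : Set α) ∈ A, {(F : Set α)} := by
    ext s
    lift s to Finset α using s.toFinite
    simp [and_comm]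
  rw [measureReal_def, setBernoulli_apply_eq_apply_subsets, ← measureReal_def, hfibre,
    measureReal_biUnion_finset (by intro F _ F' _ hne; simpa using hne)
      fun F _ => measurableSet_singleton _, Finset.sum_filter]
  refine Finset.sum_congr rfl fun F hF => ?_
  have hFE : (F : Set α) ⊆ E := Finset.coe_subset.2 (Finset.mem_powerset.1 hF)
  by_cases hFA : (F : Set α) ∈ A
  · simp only [hFA, if_true, mul_one]
    rw [setBernoulli_real_singleton p hFE E.finite_toSet, Set.ncard_coe_finset,
      Set.ncard_sdiff hFE, Set.ncard_coe_finset, Set.ncard_coe_finset]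
  · simp only [hFA, if_false, mul_zero]

lemma randomSubgraph_real_eq_prob (G : SimpleGraph V) [Fintype G.edgeSet] (p : I)
    (A : Set (SimpleGraph V)) :
    (randomSubgraph G p).real A =
      prob G.edgeFinset p fun F => SimpleGraph.fromEdgeSet (F : Set (Sym2 V)) ∈ A := by
  classical
  rw [randomSubgraph, map_measureReal_apply SimpleGraph.measurable_fromEdgeSet
    (measurableSet_of_finite A), ← SimpleGraph.coe_edgeFinset, setBernoulli_real_eq_prob]
  rfl

end Law

/-- An adaptive exploration of a random subset of `E`: in state `s` it may ask whether an element
not asked before belongs to the random set, and moves on according to the answer. The answer given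
to `next` is `false` when nothing is asked. -/
structure Exploration (α τ : Type*) [DecidableEq α] (E : Finset α) where
  ask : τ → Option α
  next : τ → Bool → τ
  /-- the elements asked so far -/
  asked : τ → Finset α
  mem_of_ask : ∀ {s e}, ask s = some e → e ∈ E
  notMem_of_ask : ∀ {s e}, ask s = some e → e ∉ asked s
  asked_next_some : ∀ {s e} (b), ask s = some e → asked (next s b) = insert e (asked s)
  asked_next_none : ∀ {s} (b), ask s = none → asked (next s b) = asked s

namespace Exploration

variable {α τ : Type*} [DecidableEq α] {E : Finset α} (X : Exploration α τ E)

/-- The answer obtained in state `s` if the random set is `F`. -/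
def answer (F : Finset α) (s : τ) : Bool :=
  match X.ask s with
  | some e => decide (e ∈ F)
  | none => false

/-- The state after `i` steps, starting in `s`. -/
def run (F : Finset α) (s : τ) (i : ℕ) : τ := (fun s => X.next s (X.answer F s))^[i] s

/-- The number of questions asked in the steps `t` with `i ≤ t < j`. -/
def queries (F : Finset α) (s : τ) (i j : ℕ) : ℕ :=
  ((Finset.Ico i j).filter fun t => (X.ask (X.run F s t)).isSome).card

/-- The number of positive answers in the steps `t` with `i ≤ t < j`. -/
def positives (F : Finset α) (s : τ) (i j : ℕ) : ℕ :=
  ((Finset.Ico i j).filter fun t => X.answer F (X.run F s t) = true).card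

/-- The contribution of one step to `weight`; it is trivial if nothing is asked. -/
def factor (φ : Bool → ℝ) (F : Finset α) (s : τ) : ℝ :=
  if (X.ask s).isSome then φ (X.answer F s) else 1

/-- The product of the values `φ t` of the answers obtained in the steps `t < m`. -/
def weight (φ : ℕ → Bool → ℝ) (F : Finset α) (s : τ) (m : ℕ) : ℝ :=
  ∏ t ∈ Finset.range m, X.factor (φ t) F (X.run F s t)

lemma answer_some {F : Finset α} {s : τ} {e : α} (h : X.ask s = some e) :
    X.answer F s = decide (e ∈ F) := by
  simp only [answer, h]

lemma answer_none {F : Finset α} {s : τ} (h : X.ask s = none) : X.answer F s = false := by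
  simp only [answer, h]

lemma run_succ (F : Finset α) (s : τ) (i : ℕ) :
    X.run F s (i + 1) = X.next (X.run F s i) (X.answer F (X.run F s i)) :=
  Function.iterate_succ_apply' _ _ _

lemma queries_succ (F : Finset α) (s : τ) {i j : ℕ} (hij : i ≤ j) :
    X.queries F s i (j + 1) =
      X.queries F s i j + if (X.ask (X.run F s j)).isSome then 1 else 0 := by
  rw [queries, ← Finset.insert_Ico_right_eq_Ico_add_one hij, Finset.filter_insert]
  split_ifs
  · rw [Finset.card_insert_of_notMem (by simp), queries]
  · rfl

lemma positives_succ (F : Finset α) (s : τ) {i j : ℕ} (hij : i ≤ j) :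
    X.positives F s i (j + 1) =
      X.positives F s i j + if X.answer F (X.run F s j) = true then 1 else 0 := by
  rw [positives, ← Finset.insert_Ico_right_eq_Ico_add_one hij, Finset.filter_insert]
  split_ifs
  · rw [Finset.card_insert_of_notMem (by simp), positives]
  · rfl

lemma positives_full_eq_queries (s : τ) (i j : ℕ) : X.positives E s i j = X.queries E s i j := by
  unfold positives queries
  congr 1
  refine Finset.filter_congr fun t _ => ?_
  rcases h : X.ask (X.run E s t) with _ | e
  · simp only [X.answer_none h, Option.isSome_none]
  · simp only [X.answer_some h, X.mem_of_ask h, decide_true, Option.isSome_some]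

lemma asked_run_mono (F : Finset α) (s : τ) : Monotone fun i => X.asked (X.run F s i) := by
  refine monotone_nat_of_le_succ fun i => ?_
  rw [run_succ]
  rcases h : X.ask (X.run F s i) with _ | e
  · rw [X.asked_next_none _ h]
  · rw [X.asked_next_some _ h]
    exact Finset.subset_insert _ _

lemma asked_run_subset {F : Finset α} {s : τ} (hs : X.asked s ⊆ E) (i : ℕ) :
    X.asked (X.run F s i) ⊆ E := by
  induction i with
  | zero => exact hs
  | succ i ih =>
    rw [run_succ]
    rcases h : X.ask (X.run F s i) with _ | e
    · rwa [X.asked_next_none _ h]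
    · rw [X.asked_next_some _ h]
      exact Finset.insert_subset (X.mem_of_ask h) ih

lemma card_asked_run (F : Finset α) (s : τ) {i j : ℕ} (hij : i ≤ j) :
    (X.asked (X.run F s j)).card = (X.asked (X.run F s i)).card + X.queries F s i j := by
  induction j, hij using Nat.le_induction with
  | base => simp [queries]
  | succ j hj ih =>
    rw [X.queries_succ F s hj, ← add_assoc, ← ih, run_succ]
    rcases h : X.ask (X.run F s j) with _ | e
    · simp [X.asked_next_none _ h]
    · simp [X.asked_next_some _ h, Finset.card_insert_of_notMem (X.notMem_of_ask h)]

lemma card_asked_run_sdiff (F : Finset α) (s : τ) {i j : ℕ} (hij : i ≤ j) :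
    (X.asked (X.run F s j) \ X.asked (X.run F s i)).card = X.queries F s i j := by
  rw [Finset.card_sdiff_of_subset (X.asked_run_mono F s hij), X.card_asked_run F s hij,
    Nat.add_sub_cancel_left]

lemma weight_succ (φ : ℕ → Bool → ℝ) (F : Finset α) (s : τ) (m : ℕ) :
    X.weight φ F s (m + 1) =
      X.factor (φ 0) F s * X.weight (fun t => φ (t + 1)) F (X.next s (X.answer F s)) m := by
  rw [weight, Finset.prod_range_succ', mul_comm]
  rfl

/-- The factor `g`, which does not depend on the elements asked from `s` on, lets the induction
condition on the first answer. -/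
lemma expect_mul_weight {p : ℝ} (m : ℕ) {φ : ℕ → Bool → ℝ}
    (hφ : ∀ t, p * φ t true + (1 - p) * φ t false = 1) (s : τ) {g : Finset α → ℝ}
    (hg : ∀ F, ∀ e ∉ X.asked s, g (insert e F) = g F) :
    expect E p (fun F => g F * X.weight φ F s m) = expect E p g := by
  induction m generalizing φ s g with
  | zero => simp only [weight, Finset.prod_range_zero, mul_one]
  | succ m ih =>
    simp only [weight_succ]
    rcases hask : X.ask s with _ | e
    · simp only [factor, hask, Option.isSome_none, Bool.false_eq_true, if_false, one_mul,
        X.answer_none hask]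
      exact ih (fun t => hφ (t + 1)) _ (by rwa [X.asked_next_none _ hask])
    · have hge : ∀ F, g (insert e F) = g F := fun F => hg F e (X.notMem_of_ask hask)
      set rest : Bool → Finset α → ℝ := fun b F =>
        X.weight (fun t => φ (t + 1)) F (X.next s b) m
      have hsplit : ∀ F, g F * (X.factor (φ 0) F s * rest (X.answer F s) F) =
          φ 0 true * ((if e ∈ F then 1 else 0) * g F * rest true F) +
          φ 0 false * ((if e ∈ F then 0 else 1) * g F * rest false F) := fun F => by
        by_cases heF : e ∈ F <;> simp [factor, hask, X.answer_some hask, heF] <;> ring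
      have hrest : ∀ (b : Bool) (x y : ℝ),
          expect E p (fun F => (if e ∈ F then x else y) * g F * rest b F) =
            (p * x + (1 - p) * y) * expect E p g := fun b x y => by
        rw [← expect_ite_mem_mul (X.mem_of_ask hask) p x y hge]
        refine ih (fun t => hφ (t + 1)) _ fun F e' he' => ?_
        rw [X.asked_next_some _ hask, Finset.mem_insert, not_or] at he'
        simp only [hg _ _ he'.2, Finset.mem_insert, Ne.symm he'.1, false_or]
      change expect E p (fun F => g F * (X.factor (φ 0) F s * rest (X.answer F s) F)) = _
      simp only [hsplit]
      rw [expect_add, expect_const_mul, expect_const_mul, hrest, hrest]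
      linear_combination expect E p g * hφ 0

/-- Between the steps `i` and `j` there are too few positive answers for the number of questions,
if each answer is positive with probability `p`. -/
def BadWindow (p β η : ℝ) (F : Finset α) (s : τ) (i j : ℕ) : Prop :=
  (1 + β) * X.positives F s i j + η ≤ p * X.queries F s i j

/-- The exponential tilt used in the Chernoff bound for `BadWindow`: from step `i` on, a positive
answer costs a factor `1 - β`, normalised to mean one. -/
noncomputable def tilt (p β : ℝ) (i t : ℕ) (b : Bool) : ℝ :=
  if i ≤ t then (if b then 1 - β else 1) / (1 - p * β) else 1

lemma tilt_mean {p β : ℝ} (h : p * β < 1) (i t : ℕ) :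
    p * tilt p β i t true + (1 - p) * tilt p β i t false = 1 := by
  have : 1 - p * β ≠ 0 := (sub_pos.2 h).ne'
  by_cases hi : i ≤ t
  · simp only [tilt, hi, if_true, Bool.false_eq_true, if_false]
    field_simp
    ring
  · simp only [tilt, hi, if_false]
    ring

lemma weight_tilt (p β : ℝ) (F : Finset α) (s : τ) (i j : ℕ) :
    X.weight (tilt p β i) F s j =
      (1 - β) ^ X.positives F s i j / (1 - p * β) ^ X.queries F s i j := by
  have hfactor : ∀ t, X.factor (tilt p β i t) F (X.run F s t) =
      (if i ≤ t ∧ X.answer F (X.run F s t) = true then 1 - β else 1) /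
        (if i ≤ t ∧ (X.ask (X.run F s t)).isSome then 1 - p * β else 1) := fun t => by
    rcases h : X.ask (X.run F s t) with _ | e
    · simp [factor, h, X.answer_none h]
    · by_cases hi : i ≤ t <;> simp [factor, tilt, h, hi]
  rw [weight, Finset.prod_congr rfl fun t _ => hfactor t, Finset.prod_div_distrib,
    Finset.prod_ite, Finset.prod_ite]
  simp only [Finset.prod_const, one_pow, mul_one, positives, queries]
  congr 3 <;> ext t <;> simp only [Finset.mem_filter, Finset.mem_range, Finset.mem_Ico] <;> tauto

lemma exp_neg_le_one_sub {β : ℝ} (hβ0 : 0 ≤ β) (hβ1 : β ≤ 1 / 2) :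
    Real.exp (-(β * (1 + β))) ≤ 1 - β := by
  rw [Real.exp_neg, inv_le_comm₀ (Real.exp_pos _) (by linarith)]
  refine le_trans ?_ (Real.quadratic_le_exp_of_nonneg (by positivity))
  have hfactor : 1 + β * (1 + β) + (β * (1 + β)) ^ 2 / 2 - (1 - β)⁻¹ =
      β ^ 2 * ((1 - β) * (1 + β) ^ 2 - 2 * β) / (2 * (1 - β)) := by
    have : 1 - β ≠ 0 := by linarith
    field_simp
    ring
  have hnonneg : 0 ≤ (1 - β) * (1 + β) ^ 2 - 2 * β := by nlinarith
  have : 0 ≤ 1 - β := by linarith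
  have := div_nonneg (mul_nonneg (sq_nonneg β) hnonneg) (by linarith : 0 ≤ 2 * (1 - β))
  linarith

lemma exp_le_weight_tilt {p β η : ℝ} (hpβ : p * β < 1) (hβ0 : 0 ≤ β) (hβ1 : β ≤ 1 / 2)
    {F : Finset α} {s : τ} {i j : ℕ} (h : X.BadWindow p β η F s i j) :
    Real.exp (β * η) ≤ X.weight (tilt p β i) F s j := by
  have hpos : 0 < (1 - p * β) ^ X.queries F s i j := pow_pos (sub_pos.2 hpβ) _
  rw [weight_tilt, le_div_iff₀ hpos]
  calc Real.exp (β * η) * (1 - p * β) ^ X.queries F s i j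
      ≤ Real.exp (β * η) * Real.exp (-(p * β)) ^ X.queries F s i j := by
        gcongr
        exact Real.one_sub_le_exp_neg _
    _ = Real.exp (β * η - p * β * X.queries F s i j) := by
        rw [← Real.exp_nat_mul, ← Real.exp_add]
        ring_nf
    _ ≤ Real.exp (X.positives F s i j * (-(β * (1 + β)))) := by
        refine Real.exp_le_exp.2 ?_
        have := mul_le_mul_of_nonneg_left h hβ0
        linarith
    _ = Real.exp (-(β * (1 + β))) ^ X.positives F s i j := Real.exp_nat_mul _ _
    _ ≤ (1 - β) ^ X.positives F s i j := by
        gcongr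
        exact exp_neg_le_one_sub hβ0 hβ1

lemma prob_badWindow_le {p β : ℝ} (hp0 : 0 ≤ p) (hp1 : p ≤ 1) (hβ0 : 0 ≤ β) (hβ1 : β ≤ 1 / 2)
    (η : ℝ) (s : τ) (i j : ℕ) :
    prob E p (fun F => X.BadWindow p β η F s i j) ≤ Real.exp (-(β * η)) := by
  have hpβ : p * β < 1 := by nlinarith
  have hmean : expect E p (fun F => X.weight (tilt p β i) F s j) = 1 := by
    simpa only [one_mul, expect_const] using
      X.expect_mul_weight j (tilt_mean hpβ i) s (g := fun _ => 1) fun _ _ _ => rfl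
  have hnonneg : ∀ F, 0 ≤ X.weight (tilt p β i) F s j := fun F => by
    rw [weight_tilt]
    exact div_nonneg (pow_nonneg (by linarith) _) (pow_nonneg (by linarith) _)
  have hmarkov := mul_prob_le_expect (E := E) hp0 hp1 hnonneg
    fun F => X.exp_le_weight_tilt (F := F) (η := η) (s := s) (j := j) hpβ hβ0 hβ1
  rw [hmean] at hmarkov
  rwa [Real.exp_neg, ← one_div, le_div_iff₀' (Real.exp_pos _)]

lemma prob_exists_badWindow_le {p β : ℝ} (hp0 : 0 ≤ p) (hp1 : p ≤ 1) (hβ0 : 0 ≤ β)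
    (hβ1 : β ≤ 1 / 2) (η : ℝ) (s : τ) (N : ℕ) :
    prob E p (fun F => ∃ i ≤ N, ∃ j ≤ N, X.BadWindow p β η F s i j) ≤
      (N + 1) ^ 2 * Real.exp (-(β * η)) := by
  set W := Finset.range (N + 1) ×ˢ Finset.range (N + 1)
  calc prob E p (fun F => ∃ i ≤ N, ∃ j ≤ N, X.BadWindow p β η F s i j)
      ≤ prob E p (fun F => ∃ ij ∈ W, X.BadWindow p β η F s ij.1 ij.2) := by
        refine prob_mono hp0 hp1 fun F _ => ?_
        rintro ⟨i, hi, j, hj, h⟩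
        exact ⟨(i, j), by simp [W, hi, hj], h⟩
    _ ≤ ∑ ij ∈ W, prob E p (fun F => X.BadWindow p β η F s ij.1 ij.2) :=
        prob_exists_le hp0 hp1 W _
    _ ≤ ∑ _ij ∈ W, Real.exp (-(β * η)) :=
        Finset.sum_le_sum fun ij _ => X.prob_badWindow_le hp0 hp1 hβ0 hβ1 η s ij.1 ij.2
    _ = (N + 1) ^ 2 * Real.exp (-(β * η)) := by
        simp [W, sq]

end Exploration

/-- The state of a depth first search: the stack, the vertices not yet seen, and the edges of which
it is known whether they belong to the random graph. -/
structure DFSState (V : Type*) where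
  /-- the path from the root of the current tree to the current vertex, which comes first -/
  stack : List V
  /-- the vertices not yet discovered -/
  unseen : Finset V
  /-- the edges already asked about -/
  asked : Finset (Sym2 V)

namespace DFSState

variable {V : Type*} [DecidableEq V] {G : SimpleGraph V} {F : Finset (Sym2 V)} {U : Finset V}
  {s s' : DFSState V}

/-- The next pair to be asked: the current vertex, and an unseen neighbour of it. -/
noncomputable def query (G : SimpleGraph V) (s : DFSState V) : Option (V × V) :=
  open Classical in
  match s.stack with
  | [] => none
  | u :: _ =>
    if h : ∃ y ∈ s.unseen, G.Adj u y ∧ s(u, y) ∉ s.asked then some (u, h.choose) else none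

/-- One step of depth first search; `b` is the answer to the query, if there is one. Without a
query the current vertex is removed from the stack, or a new root is chosen if the stack is
empty. -/
noncomputable def next (G : SimpleGraph V) (s : DFSState V) (b : Bool) : DFSState V :=
  open Classical in
  match s.query G with
  | some (u, y) =>
    if b then ⟨y :: s.stack, s.unseen.erase y, insert s(u, y) s.asked⟩
    else ⟨s.stack, s.unseen, insert s(u, y) s.asked⟩
  | none =>
    match s.stack with
    | _ :: t => ⟨t, s.unseen, s.asked⟩
    | [] => if h : s.unseen.Nonempty then ⟨[h.choose], s.unseen.erase h.choose, s.asked⟩ else s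

lemma query_eq_some {u y : V} (h : s.query G = some (u, y)) :
    (∃ t, s.stack = u :: t) ∧ y ∈ s.unseen ∧ G.Adj u y ∧ s(u, y) ∉ s.asked := by
  unfold query at h
  split at h
  · simp at h
  · rename_i v t hs
    split_ifs at h with hex
    simp only [Option.some.injEq, Prod.mk.injEq] at h
    obtain ⟨rfl, rfl⟩ := h
    exact ⟨⟨t, hs⟩, hex.choose_spec⟩

lemma mem_asked_of_query_eq_none (h : s.query G = none) {u : V} {t : List V}
    (hs : s.stack = u :: t) {y : V} (hy : y ∈ s.unseen) (hadj : G.Adj u y) :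
    s(u, y) ∈ s.asked := by
  unfold query at h
  rw [hs] at h
  simp only at h
  split_ifs at h with hex
  by_contra hc
  exact hex ⟨y, hy, hadj, hc⟩

/-- The possible steps of a depth first search in the random graph with edge set `F`. -/
inductive Step (G : SimpleGraph V) (F : Finset (Sym2 V)) : DFSState V → DFSState V → Prop
  | push {u y : V} {t : List V} {U : Finset V} {A : Finset (Sym2 V)} (hy : y ∈ U)
      (hadj : G.Adj u y) (hA : s(u, y) ∉ A) (hF : s(u, y) ∈ F) :
      Step G F ⟨u :: t, U, A⟩ ⟨y :: u :: t, U.erase y, insert s(u, y) A⟩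
  | reject {u y : V} {t : List V} {U : Finset V} {A : Finset (Sym2 V)} (hA : s(u, y) ∉ A) :
      Step G F ⟨u :: t, U, A⟩ ⟨u :: t, U, insert s(u, y) A⟩
  | pop {u : V} {t : List V} {U : Finset V} {A : Finset (Sym2 V)}
      (h : ∀ y ∈ U, G.Adj u y → s(u, y) ∈ A) : Step G F ⟨u :: t, U, A⟩ ⟨t, U, A⟩
  | root {y : V} {U : Finset V} {A : Finset (Sym2 V)} (hy : y ∈ U) :
      Step G F ⟨[], U, A⟩ ⟨[y], U.erase y, A⟩
  | done {A : Finset (Sym2 V)} : Step G F ⟨[], ∅, A⟩ ⟨[], ∅, A⟩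

namespace Step

lemma unseen_subset (h : Step G F s s') : s'.unseen ⊆ s.unseen := by
  cases h <;> simp [Finset.erase_subset]

lemma card_unseen_le (h : Step G F s s') : s.unseen.card ≤ s'.unseen.card + 1 := by
  cases h with
  | push hy => exact (Finset.card_erase_add_one hy).ge
  | root hy => exact (Finset.card_erase_add_one hy).ge
  | _ => exact Nat.le_succ _

lemma length_stack_le (h : Step G F s s') : s'.stack.length ≤ s.stack.length + 1 := by
  cases h <;> simp only [List.length_cons, List.length_nil] <;> omega

lemma le_length_stack (h : Step G F s s') : s.stack.length ≤ s'.stack.length + 1 := by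
  cases h <;> simp only [List.length_cons, List.length_nil] <;> omega

lemma exists_stack_eq_cons (h : Step G F s s') {x : V} (hx : x ∈ s.unseen) (hx' : x ∉ s'.unseen) :
    ∃ t, s'.stack = x :: t := by
  cases h with
  | @push u y t =>
    obtain rfl : x = y := by by_contra hne; exact hx' (Finset.mem_erase.2 ⟨hne, hx⟩)
    exact ⟨_, rfl⟩
  | @root y =>
    obtain rfl : x = y := by by_contra hne; exact hx' (Finset.mem_erase.2 ⟨hne, hx⟩)
    exact ⟨_, rfl⟩
  | _ => exact absurd hx hx'

lemma exists_stack_eq_append (h : Step G F s s') {A S : List V} (hA : s.stack = A ++ S)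
    (hS : S.length ≤ s'.stack.length) :
    ∃ B, s'.stack = B ++ S ∧ ∀ b ∈ B, b ∈ A ∨ b ∈ s.unseen := by
  cases h with
  | @push u y t _ _ hy =>
    simp only at hA ⊢
    refine ⟨y :: A, by rw [hA]; rfl, fun b hb => ?_⟩
    rcases List.mem_cons.1 hb with rfl | hb
    · exact Or.inr hy
    · exact Or.inl hb
  | reject => exact ⟨A, hA, fun b hb => Or.inl hb⟩
  | @pop u t =>
    simp only at hA hS ⊢
    rcases A with _ | ⟨a, A⟩
    · simp [← hA.trans (List.nil_append S)] at hS
    · exact ⟨A, (List.cons.inj hA).2, fun b hb => Or.inl (List.mem_cons_of_mem _ hb)⟩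
  | @root y _ _ hy =>
    obtain ⟨-, rfl⟩ := List.append_eq_nil_iff.1 hA.symm
    exact ⟨[y], rfl, fun b hb => Or.inr (by simpa [List.mem_singleton.1 hb] using hy)⟩
  | done => exact ⟨A, hA, fun b hb => Or.inl hb⟩

lemma eq_of_stack_eq_nil (h : Step G F s s') (hnil : s.stack = []) (hempty : s.unseen = ∅) :
    s' = s := by
  cases h with
  | root hy => exact absurd (hempty.subset hy) (Finset.notMem_empty _)
  | done => rfl
  | _ => cases hnil

lemma potential_lt (h : Step G F s s') (hs : s.stack = [] → s.unseen ≠ ∅) :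
    s'.stack.length + 2 * s'.unseen.card + s.asked.card <
      s.stack.length + 2 * s.unseen.card + s'.asked.card := by
  cases h with
  | push hy _ hA =>
    simp only [List.length_cons]
    rw [Finset.card_insert_of_notMem hA, ← Finset.card_erase_add_one hy]
    omega
  | reject hA =>
    simp only
    rw [Finset.card_insert_of_notMem hA]
    omega
  | pop =>
    simp only [List.length_cons]
    omega
  | root hy =>
    simp only [List.length_cons, List.length_nil]
    rw [← Finset.card_erase_add_one hy]
    omega
  | done => exact absurd rfl (hs rfl)

end Step

/-- What holds throughout a depth first search in the random graph with edge set `F` that is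
started with the vertices of `U` unseen. -/
structure Invariant (G : SimpleGraph V) (F : Finset (Sym2 V)) (U : Finset V) (s : DFSState V) :
    Prop where
  unseen_subset : s.unseen ⊆ U
  stack_notMem_unseen : ∀ v ∈ s.stack, v ∉ s.unseen
  nodup_stack : s.stack.Nodup
  isChain_stack : s.stack.IsChain (fromEdgeSet (F : Set (Sym2 V))).Adj
  /-- all edges between processed and unseen vertices have been asked -/
  mem_asked : ∀ x ∈ U, x ∉ s.unseen → x ∉ s.stack → ∀ y ∈ s.unseen, G.Adj x y → s(x, y) ∈ s.asked
  notMem_asked : ∀ x ∈ s.unseen, ∀ y ∈ s.unseen, s(x, y) ∉ s.asked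

lemma notMem_insert_asked {u w x y : V} {A : Finset (Sym2 V)} {W : Finset V} (hu : u ∉ W)
    (hx : x ∈ W) (hy : y ∈ W) (hA : s(x, y) ∉ A) : s(x, y) ∉ insert s(u, w) A := by
  rw [Finset.mem_insert, not_or]
  refine ⟨fun heq => ?_, hA⟩
  rcases Sym2.eq_iff.1 heq with ⟨rfl, -⟩ | ⟨-, rfl⟩
  · exact hu hx
  · exact hu hy

lemma Invariant.step (hs : s.Invariant G F U) (h : Step G F s s') : s'.Invariant G F U := by
  obtain ⟨hU, hSun, hnd, hch, hasked, hfresh⟩ := hs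
  cases h with
  | @push u y t W A hy hadj hA hF =>
    refine ⟨(W.erase_subset y).trans hU,
      List.forall_mem_cons.2 ⟨W.notMem_erase y, fun v hv hvW => hSun v hv (W.erase_subset y hvW)⟩,
      List.nodup_cons.2 ⟨fun hyt => hSun y hyt hy, hnd⟩, List.isChain_cons_cons.2 ⟨?_, hch⟩,
      fun x hxU hx hxt z hz hxz => ?_, fun x hx z hz => ?_⟩
    · rw [SimpleGraph.fromEdgeSet_adj, Sym2.eq_swap]
      exact ⟨hF, hadj.ne'⟩
    · obtain ⟨hxy, hxt⟩ := not_or.1 (mt List.mem_cons.2 hxt)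
      exact Finset.mem_insert_of_mem <| hasked x hxU
        (fun hxW => hx (Finset.mem_erase.2 ⟨hxy, hxW⟩)) hxt z (Finset.mem_of_mem_erase hz) hxz
    · exact notMem_insert_asked (hSun u List.mem_cons_self) (Finset.mem_of_mem_erase hx)
        (Finset.mem_of_mem_erase hz)
        (hfresh x (Finset.mem_of_mem_erase hx) z (Finset.mem_of_mem_erase hz))
  | @reject u y t W A hA =>
    exact ⟨hU, hSun, hnd, hch,
      fun x hxU hx hxt z hz hxz => Finset.mem_insert_of_mem (hasked x hxU hx hxt z hz hxz),
      fun x hx z hz => notMem_insert_asked (hSun u List.mem_cons_self) hx hz (hfresh x hx z hz)⟩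
  | @pop u t W A hpop =>
    refine ⟨hU, fun v hv => hSun v (List.mem_cons_of_mem _ hv), (List.nodup_cons.1 hnd).2, hch.tail,
      fun x hxU hx hxt z hz hxz => ?_, hfresh⟩
    by_cases hxu : x = u
    · exact hxu ▸ hpop z hz (hxu ▸ hxz)
    · exact hasked x hxU hx (mt List.mem_cons.1 (not_or.2 ⟨hxu, hxt⟩)) z hz hxz
  | @root y W A hy =>
    refine ⟨(W.erase_subset y).trans hU,
      fun v hv => List.mem_singleton.1 hv ▸ W.notMem_erase y, List.nodup_singleton y,
      List.isChain_singleton y, fun x hxU hx hxt z hz hxz => ?_, fun x hx z hz =>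
      hfresh x (Finset.mem_of_mem_erase hx) z (Finset.mem_of_mem_erase hz)⟩
    exact hasked x hxU (fun hxW => hx (Finset.mem_erase.2 ⟨mt List.mem_singleton.2 hxt, hxW⟩))
      List.not_mem_nil z (Finset.mem_of_mem_erase hz) hxz
  | done => exact ⟨hU, hSun, hnd, hch, hasked, hfresh⟩

/-- The vertex `y` is joined to the current vertex by a walk through seen vertices. -/
def IsLinkedTo (F : Finset (Sym2 V)) (s : DFSState V) (y : V) : Prop :=
  ∀ z t, s.stack = z :: t →
    ∃ w : (fromEdgeSet (F : Set (Sym2 V))).Walk z y, ∀ v ∈ w.support, v ∉ s.unseen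

lemma IsLinkedTo.step (hs : s.Invariant G F U) (h : Step G F s s') {y : V} (hy' : y ∉ s'.unseen)
    (hroot : s.stack = [] → y ∈ s.unseen) (hlink : y ∉ s.unseen → s.IsLinkedTo F y) :
    s'.IsLinkedTo F y := by
  have linked_of_adj {x z : V} {W : Finset V} (hx : x ∉ W)
      (hxz : (fromEdgeSet (F : Set (Sym2 V))).Adj x z)
      (hz : ∃ w : (fromEdgeSet (F : Set (Sym2 V))).Walk z y, ∀ v ∈ w.support, v ∉ W) :
      ∃ w : (fromEdgeSet (F : Set (Sym2 V))).Walk x y, ∀ v ∈ w.support, v ∉ W := by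
    obtain ⟨w, hw⟩ := hz
    exact ⟨.cons hxz w, by simpa [SimpleGraph.Walk.support_cons] using ⟨hx, hw⟩⟩
  rintro z rest hz
  cases h with
  | @push u x t W A hx hadj hA hF =>
    obtain ⟨rfl, -⟩ := List.cons.inj hz
    by_cases hyx : y = x
    · exact hyx ▸ ⟨.nil, by simp⟩
    · obtain ⟨w, hw⟩ := hlink (fun hyW => hy' (Finset.mem_erase.2 ⟨hyx, hyW⟩)) u t rfl
      refine linked_of_adj (W.notMem_erase x) ?_
        ⟨w, fun v hv hvW => hw v hv (Finset.mem_of_mem_erase hvW)⟩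
      rw [SimpleGraph.fromEdgeSet_adj, Sym2.eq_swap]
      exact ⟨hF, hadj.ne'⟩
  | reject => exact hlink hy' z rest hz
  | @pop u t W A =>
    obtain rfl : t = z :: rest := hz
    exact linked_of_adj (hs.stack_notMem_unseen z (by simp))
      (List.isChain_cons_cons.1 hs.isChain_stack).1.symm (hlink hy' u _ rfl)
  | @root x W A hx =>
    obtain ⟨rfl, -⟩ := List.cons.inj hz
    obtain rfl : y = x := by
      by_contra hyx
      exact hy' (Finset.mem_erase.2 ⟨hyx, hroot rfl⟩)
    exact ⟨.nil, by simp⟩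
  | done => cases hz

end DFSState

lemma exists_walk_of_isChain_append {V : Type*} {H : SimpleGraph V} {z y : V} (q : H.Walk z y)
    {t : List V} (A : List V) {x : V} (h : (x :: A ++ z :: t).IsChain H.Adj) :
    ∃ w : H.Walk x y, w.support = x :: A ++ q.support := by
  induction A generalizing x with
  | nil => exact ⟨.cons (List.isChain_cons_cons.1 h).1 q, rfl⟩
  | cons a A ih =>
    obtain ⟨hxa, h'⟩ := List.isChain_cons_cons.1 h
    obtain ⟨w, hw⟩ := ih h'
    exact ⟨.cons hxa w, by rw [SimpleGraph.Walk.support_cons, hw]; rfl⟩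

section DepthFirstSearch

variable {V : Type*} [DecidableEq V] (G : SimpleGraph V) [Fintype G.edgeSet]

/-- Depth first search as an adaptive exploration of the random edge set. -/
noncomputable def dfs : Exploration (Sym2 V) (DFSState V) G.edgeFinset where
  ask s := (s.query G).map fun x => s(x.1, x.2)
  next := DFSState.next G
  asked := DFSState.asked
  mem_of_ask {s e} h := by
    obtain ⟨⟨u, y⟩, hq, rfl⟩ := Option.map_eq_some_iff.1 h
    simpa using (DFSState.query_eq_some hq).2.2.1
  notMem_of_ask {s e} h := by
    obtain ⟨⟨u, y⟩, hq, rfl⟩ := Option.map_eq_some_iff.1 h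
    exact (DFSState.query_eq_some hq).2.2.2
  asked_next_some {s e} b h := by
    obtain ⟨⟨u, y⟩, hq, rfl⟩ := Option.map_eq_some_iff.1 h
    cases b <;> simp [DFSState.next, hq]
  asked_next_none {s} b h := by
    have hq : s.query G = none := by simpa using h
    unfold DFSState.next
    rw [hq]
    simp only
    split
    · rfl
    · split_ifs <;> rfl

/-- The state of the depth first search in the random graph with edge set `F`, started with the
vertices of `U` unseen and all other vertices ignored. -/
noncomputable def dfsState (F : Finset (Sym2 V)) (U : Finset V) (i : ℕ) : DFSState V :=
  (dfs G).run F ⟨[], U, ∅⟩ i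

variable {G} (F : Finset (Sym2 V)) (U : Finset V)

lemma dfs_step (s : DFSState V) : DFSState.Step G F s ((dfs G).next s ((dfs G).answer F s)) := by
  rcases hq : s.query G with _ | ⟨u, y⟩
  · rw [Exploration.answer_none _ (by simp [dfs, hq])]
    change DFSState.Step G F s (DFSState.next G s false)
    unfold DFSState.next
    rw [hq]
    obtain ⟨st, W, A⟩ := s
    rcases st with _ | ⟨u, t⟩
    · simp only
      split_ifs with h
      · exact .root h.choose_spec
      · rw [Finset.not_nonempty_iff_eq_empty.1 h]
        exact .done
    · exact .pop fun y hy hadj => DFSState.mem_asked_of_query_eq_none hq rfl hy hadj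
  · have hask : (dfs G).ask s = some s(u, y) := by simp [dfs, hq]
    rw [Exploration.answer_some _ hask]
    change DFSState.Step G F s (DFSState.next G s _)
    obtain ⟨⟨t, ht⟩, hy, hadj, hA⟩ := DFSState.query_eq_some hq
    unfold DFSState.next
    rw [hq]
    obtain ⟨st, W, A⟩ := s
    obtain rfl : st = u :: t := ht
    by_cases hF : s(u, y) ∈ F
    · simpa [hF] using DFSState.Step.push hy hadj hA hF
    · simpa [hF] using DFSState.Step.reject hA

lemma card_unseen_next_add_one_le {s : DFSState V} (h : (dfs G).answer F s = true) :
    ((dfs G).next s true).unseen.card + 1 ≤ s.unseen.card := by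
  rcases hq : s.query G with _ | ⟨u, y⟩
  · simp [Exploration.answer_none (dfs G) (show (dfs G).ask s = none by simp [dfs, hq])] at h
  · have hnext : (dfs G).next s true =
        ⟨y :: s.stack, s.unseen.erase y, insert s(u, y) s.asked⟩ := by
      change DFSState.next G s true = _
      simp only [DFSState.next, hq, if_true]
    rw [hnext, Finset.card_erase_add_one (DFSState.query_eq_some hq).2.1]

lemma dfsState_succ (i : ℕ) : dfsState G F U (i + 1) =
    (dfs G).next (dfsState G F U i) ((dfs G).answer F (dfsState G F U i)) :=
  Exploration.run_succ _ _ _ _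

lemma dfsState_step (i : ℕ) :
    DFSState.Step G F (dfsState G F U i) (dfsState G F U (i + 1)) := by
  rw [dfsState_succ]
  exact dfs_step F _

lemma dfsState_invariant (i : ℕ) : (dfsState G F U i).Invariant G F U := by
  induction i with
  | zero =>
    exact ⟨subset_rfl, by simp [dfsState, Exploration.run], List.nodup_nil, List.isChain_nil,
      fun x hxU hx => absurd hxU hx, fun _ _ _ _ => Finset.notMem_empty _⟩
  | succ i ih => exact ih.step (dfsState_step F U i)

lemma unseen_antitone : Antitone fun i => (dfsState G F U i).unseen :=
  antitone_nat_of_succ_le fun i => (dfsState_step F U i).unseen_subset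

lemma card_unseen_add_positives_le {i j : ℕ} (hij : i ≤ j) :
    (dfsState G F U j).unseen.card + (dfs G).positives F ⟨[], U, ∅⟩ i j ≤
      (dfsState G F U i).unseen.card := by
  induction j, hij using Nat.le_induction with
  | base => simp [Exploration.positives]
  | succ j hj ih =>
    rw [Exploration.positives_succ _ _ _ hj]
    split_ifs with hans
    · have hlt := card_unseen_next_add_one_le F (s := dfsState G F U j) hans
      rw [← show (dfs G).answer F (dfsState G F U j) = true from hans, ← dfsState_succ] at hlt
      omega
    · have hle := Finset.card_le_card (dfsState_step (G := G) F U j).unseen_subset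
      omega

lemma dfsState_of_le {i : ℕ} (hi : 2 * U.card + G.edgeFinset.card ≤ i) :
    (dfsState G F U i).stack = [] ∧ (dfsState G F U i).unseen = ∅ := by
  have potential (i : ℕ) : ((dfsState G F U i).stack = [] ∧ (dfsState G F U i).unseen = ∅) ∨
      i + (dfsState G F U i).stack.length + 2 * (dfsState G F U i).unseen.card ≤
        2 * U.card + (dfsState G F U i).asked.card := by
    induction i with
    | zero => simp [dfsState, Exploration.run]
    | succ i ih =>
      have hstep := dfsState_step (G := G) F U i
      by_cases hend : (dfsState G F U i).stack = [] ∧ (dfsState G F U i).unseen = ∅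
      · exact Or.inl (hstep.eq_of_stack_eq_nil hend.1 hend.2 ▸ hend)
      · have hlt := hstep.potential_lt fun hnil hempty => hend ⟨hnil, hempty⟩
        have hle := ih.resolve_left hend
        right
        omega
  rcases potential i with h | h
  · exact h
  · have hasked : (dfsState G F U i).asked.card ≤ G.edgeFinset.card :=
      Finset.card_le_card ((dfs G).asked_run_subset (Finset.empty_subset _) i)
    exact ⟨List.eq_nil_of_length_eq_zero (by omega), Finset.card_eq_zero.1 (by omega)⟩

variable {F U}

lemma exists_stack_eq_append {l i : ℕ} (hli : l ≤ i) (h : ∀ t, l ≤ t → t ≤ i →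
      (dfsState G F U l).stack.length ≤ (dfsState G F U t).stack.length) :
    ∃ A, (dfsState G F U i).stack = A ++ (dfsState G F U l).stack ∧
      ∀ a ∈ A, a ∈ (dfsState G F U l).unseen := by
  induction i, hli using Nat.le_induction with
  | base => exact ⟨[], by simp⟩
  | succ i hi ih =>
    obtain ⟨A, hA, hAU⟩ := ih fun t hlt hti => h t hlt (by omega)
    obtain ⟨B, hB, hBA⟩ :=
      (dfsState_step F U i).exists_stack_eq_append hA (h (i + 1) (by omega) le_rfl)
    exact ⟨B, hB, fun b hb => (hBA b hb).elim (hAU b) (fun hb => unseen_antitone F U hi hb)⟩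

lemma isLinkedTo_of_notMem_unseen {r l : ℕ} (hrl : r ≤ l)
    (h : ∀ t, r < t → t < l → (dfsState G F U t).stack ≠ []) {y : V}
    (hy : y ∈ (dfsState G F U r).unseen) (hy' : y ∉ (dfsState G F U l).unseen) :
    (dfsState G F U l).IsLinkedTo F y := by
  induction l, hrl using Nat.le_induction with
  | base => exact absurd hy hy'
  | succ l hl ih =>
    refine DFSState.IsLinkedTo.step (dfsState_invariant F U l) (dfsState_step F U l) hy'
      (fun hnil => ?_) (ih fun t hrt htl => h t hrt (by omega))
    rcases hl.eq_or_lt with rfl | hlt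
    · exact hy
    · exact absurd hnil (h l hlt (by omega))

/-- The path runs down the stack from `x` to the vertex that is current at time `l`, and from there
to `y` through vertices seen before that time. -/
lemma exists_long_path {r l i : ℕ} (hrl : r ≤ l)
    (h : ∀ t, r < t → t ≤ l → (dfsState G F U t).stack ≠ []) (hl : (dfsState G F U l).stack ≠ [])
    {y : V} (hy : y ∈ (dfsState G F U r).unseen) (hy' : y ∉ (dfsState G F U l).unseen)
    (hli : l ≤ i) (hlen : ∀ t, l ≤ t → t ≤ i →
      (dfsState G F U l).stack.length ≤ (dfsState G F U t).stack.length)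
    {x : V} {t : List V} (hx : (dfsState G F U i).stack = x :: t)
    (hlt : (dfsState G F U l).stack.length < (dfsState G F U i).stack.length) :
    ∃ w : (fromEdgeSet (F : Set (Sym2 V))).Walk x y, w.IsPath ∧
      (dfsState G F U i).stack.length ≤ (dfsState G F U l).stack.length + w.length := by
  obtain ⟨z, t', hz⟩ := List.exists_cons_of_ne_nil hl
  obtain ⟨q, hq⟩ := isLinkedTo_of_notMem_unseen hrl (fun t hrt htl => h t hrt htl.le) hy hy' z t' hz
  obtain ⟨A, hA, hAU⟩ := exists_stack_eq_append hli hlen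
  have hinv := dfsState_invariant (G := G) F U i
  rcases A with _ | ⟨a, A⟩
  · simp [hA] at hlt
  obtain rfl : x = a := (List.cons.inj (hx.symm.trans hA)).1
  have hch := hinv.isChain_stack
  rw [hA, hz] at hch
  obtain ⟨w, hw⟩ := exists_walk_of_isChain_append q.bypass A hch
  refine ⟨w, ?_, ?_⟩
  · rw [SimpleGraph.Walk.isPath_def, hw, List.nodup_append']
    refine ⟨(hA ▸ hinv.nodup_stack).of_append_left, q.bypass_isPath.support_nodup, ?_⟩
    exact fun a ha ha' => hq a (q.support_bypass_subset_support ha') (hAU a ha)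
  · have hlenw := congrArg List.length hw
    rw [w.length_support, List.length_append, q.bypass.length_support] at hlenw
    rw [hA, List.length_append]
    omega

lemma exists_discovery {l j : ℕ} (hlj : l ≤ j) {x : V} (hx : x ∈ (dfsState G F U l).unseen)
    (hx' : x ∉ (dfsState G F U j).unseen) :
    ∃ i t, l < i ∧ i ≤ j ∧ (dfsState G F U i).stack = x :: t := by
  induction j, hlj using Nat.le_induction with
  | base => exact absurd hx hx'
  | succ j hj ih =>
    by_cases hxj : x ∈ (dfsState G F U j).unseen
    · obtain ⟨t, ht⟩ := (dfsState_step F U j).exists_stack_eq_cons hxj hx'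
      exact ⟨j + 1, t, by omega, le_rfl, ht⟩
    · obtain ⟨i, t, hli, hij, ht⟩ := ih hxj
      exact ⟨i, t, hli, by omega, ht⟩

end DepthFirstSearch

section HeightProfile

variable {h n : ℕ → ℕ} {i : ℕ}

lemma exists_eq_of_step (n0 : n 0 = 0) (hn : ∀ i, n (i + 1) ≤ n i + 1) {v : ℕ} (hv : v ≤ n i) :
    ∃ j ≤ i, n j = v := by
  induction i with
  | zero => exact ⟨0, le_rfl, by omega⟩
  | succ i ih =>
    by_cases hvi : v ≤ n i
    · obtain ⟨j, hji, hj⟩ := ih hvi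
      exact ⟨j, by omega, hj⟩
    · exact ⟨i + 1, le_rfl, by have := hn i; omega⟩

lemma exists_lt_add_of_lt_add_mul {x : ℕ → ℕ} {J D : ℕ} (hx : x 0 < x J + J * D) :
    ∃ a < J, x a < x (a + 1) + D := by
  by_contra! hc
  have hdrop : ∀ a ≤ J, x a + a * D ≤ x 0 := by
    intro a
    induction a with
    | zero => simp
    | succ a ih =>
      intro ha
      have hle := ih (by omega)
      have hstep := hc a (by omega)
      rw [add_mul, one_mul]
      omega
  exact absurd (hdrop J le_rfl) (by omega)

/-- The last time up to `i` at which the height is at most `v`. -/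
def lastVisit (h : ℕ → ℕ) (i v : ℕ) : ℕ := Nat.findGreatest (fun t => h t ≤ v) i

lemma lt_height_of_lastVisit_lt {v t : ℕ} (ht : lastVisit h i v < t) (hti : t ≤ i) : v < h t :=
  not_le.1 (Nat.findGreatest_is_greatest (P := fun t => h t ≤ v) ht hti)

lemma le_lastVisit {v s : ℕ} (hsi : s ≤ i) (hsv : h s ≤ v) : s ≤ lastVisit h i v :=
  Nat.le_findGreatest hsi hsv

lemma lastVisit_mono (h : ℕ → ℕ) (i : ℕ) : Monotone (lastVisit h i) := fun _ _ hvw =>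
  Nat.findGreatest_mono_left (fun _ ht => ht.trans hvw) i

lemma height_lastVisit_le (h0 : h 0 = 0) (i v : ℕ) : h (lastVisit h i v) ≤ v :=
  Nat.findGreatest_spec (P := fun t => h t ≤ v) (Nat.zero_le i) (h0.trans_le v.zero_le)

lemma lastVisit_lt (h0 : h 0 = 0) {v : ℕ} (hv : v < h i) : lastVisit h i v < i := by
  refine (Nat.findGreatest_le i).lt_of_ne fun heq => ?_
  have hle := height_lastVisit_le h0 i v
  rw [lastVisit, heq] at hle
  omega

lemma height_lastVisit (h0 : h 0 = 0) (hh : ∀ i, h (i + 1) ≤ h i + 1) {v : ℕ} (hv : v < h i) :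
    h (lastVisit h i v) = v := by
  have hle := height_lastVisit_le h0 i v
  have hlt := lt_height_of_lastVisit_lt (Nat.lt_succ_self _) (lastVisit_lt h0 hv)
  have hstep := hh (lastVisit h i v)
  simp only [Nat.succ_eq_add_one] at hlt
  omega

/-- At time `i` the height exceeds by at most `L` each height attained while the last `K` vertices
were discovered; `n i` is the number of vertices discovered up to time `i`. -/
def IsFlatAt (h n : ℕ → ℕ) (K L i : ℕ) : Prop :=
  ∃ j ≤ i, n j + K = n i ∧ ∀ t, j ≤ t → t ≤ i → h i ≤ h t + L

lemma exists_lt_of_not_isFlatAt (n0 : n 0 = 0) (hmono : Monotone n)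
    (hn : ∀ i, n (i + 1) ≤ n i + 1) {K L : ℕ} (hi : ¬ IsFlatAt h n K L i) (hK : K ≤ n i) :
    ∃ s ≤ i, n i ≤ n s + K ∧ h s + L < h i := by
  obtain ⟨j, hj, hjv⟩ := exists_eq_of_step n0 hn (Nat.sub_le (n i) K)
  by_contra! hc
  refine hi ⟨j, hj, by omega, fun s hjs hsi => hc s hsi ?_⟩
  have := hmono hjs
  omega

lemma exists_le_of_forall_not_isFlatAt (n0 : n 0 = 0) (hmono : Monotone n)
    (hn : ∀ i, n (i + 1) ≤ n i + 1) {K L : ℕ} (hi : ∀ t ≤ i, ¬ IsFlatAt h n K L t) (m : ℕ)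
    (hm : m * K ≤ n i) : ∃ s ≤ i, n i ≤ n s + m * K ∧ h s + m * (L + 1) ≤ h i := by
  induction m with
  | zero => exact ⟨i, le_rfl, by simp, by simp⟩
  | succ m ih =>
    simp only [add_mul, one_mul] at hm ⊢
    obtain ⟨s, hsi, hns, hhs⟩ := ih (by omega)
    obtain ⟨r, hrs, hnr, hhr⟩ := exists_lt_of_not_isFlatAt n0 hmono hn (hi s hsi) (by omega)
    exact ⟨r, by omega, by omega, by omega⟩

/-- A short period `l', …, l` in which the height grows by `g`, followed by a period `l, …, i` in
which at least `J * Δ` vertices are discovered and the height does not return to its earlier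
values. -/
structure IsGrowthWindow (h n : ℕ → ℕ) (J Δ g l' l i : ℕ) : Prop where
  le : l' ≤ l
  lt : l < i
  add_le : n l + J * Δ ≤ n i
  le_add : n i ≤ n l + 2 * (J * Δ) + 1
  short : n l ≤ n l' + Δ + 1
  height_pos : 1 ≤ h l'
  height_eq : h l = h l' + g
  height_lt : ∀ t, l < t → t ≤ i → h l < h t
  le_height : ∀ t, l' ≤ t → t ≤ i → h l' ≤ h t
  height_le_add : h i ≤ h l + 2 * (J * g) + 1

/-- Of the last visits at the `J + 1` levels `h i - J * g - 1 - a * g`, two consecutive ones are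
close to each other. -/
lemma IsFlatAt.exists_isGrowthWindow {J Δ g : ℕ} (hflat : IsFlatAt h n (J * Δ) (J * g) i)
    (h0 : h 0 = 0) (hh : ∀ i, h (i + 1) ≤ h i + 1) (hmono : Monotone n) (hJ : 1 ≤ J)
    (hi : 2 * (J * g) + 2 ≤ h i) {s : ℕ} (hsi : s ≤ i) (hs : h s + 2 * (J * g) + 1 ≤ h i)
    (hns : n i ≤ n s + 2 * (J * Δ) + 1) : ∃ l' l, IsGrowthWindow h n J Δ g l' l i := by
  obtain ⟨v, hv⟩ : ∃ v : ℕ → ℕ, ∀ a, v a = h i - J * g - 1 - a * g := ⟨_, fun _ => rfl⟩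
  set f : ℕ → ℕ := fun a => lastVisit h i (v a)
  have hvlt (a : ℕ) : v a < h i := by rw [hv]; omega
  have hsf {a : ℕ} (ha : a ≤ J) : s ≤ f a := by
    have := Nat.mul_le_mul_right g ha
    exact le_lastVisit hsi (by rw [hv]; omega)
  have hanti : Antitone f := fun a b hab => by
    have := Nat.mul_le_mul_right g hab
    exact lastVisit_mono h i (by rw [hv, hv]; omega)
  have hheight (a : ℕ) : h (f a) = v a := height_lastVisit h0 hh (hvlt a)
  have hlt (a t : ℕ) (hat : f a < t) (hti : t ≤ i) : v a < h t := lt_height_of_lastVisit_lt hat hti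
  obtain ⟨j, -, hnj, hflat⟩ := hflat
  have hf0 : n (f 0) + J * Δ ≤ n i := by
    have hfj : f 0 ≤ j := by
      by_contra! hjf
      have hle := hflat (f 0) hjf.le (lastVisit_lt h0 (hvlt 0)).le
      rw [hheight, hv] at hle
      omega
    exact hnj ▸ Nat.add_le_add_right (hmono hfj) _
  obtain ⟨a, ha, hgap⟩ : ∃ a < J, n (f a) < n (f (a + 1)) + (Δ + 2) := by
    refine exists_lt_add_of_lt_add_mul (x := fun a => n (f a)) ?_
    have := hmono (hsf (le_refl J))
    simp only [mul_add]
    omega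
  have hva := hv a
  have hva' := hv (a + 1)
  have hJa := Nat.mul_le_mul_right g (Nat.succ_le_of_lt ha)
  simp only [Nat.succ_eq_add_one, add_mul, one_mul] at hva' hJa
  have hna := hmono (hanti (Nat.zero_le a))
  have hnsa := hmono (hsf ha.le)
  refine ⟨f (a + 1), f a, hanti a.le_succ, lastVisit_lt h0 (hvlt a), by omega, by omega, by omega,
    ?_, ?_, fun t hat hti => hheight a ▸ hlt a t hat hti, fun t hat hti => ?_, ?_⟩
  · rw [hheight]; omega
  · rw [hheight, hheight]; omega
  · rcases hat.eq_or_lt with rfl | hat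
    · exact le_rfl
    · exact hheight (a + 1) ▸ (hlt (a + 1) t hat hti).le
  · rw [hheight]; omega

/-- The witness is the first time at which the height is flat. -/
lemma exists_isGrowthWindow_or_height_le {J Δ g N : ℕ} (h0 : h 0 = 0) (n0 : n 0 = 0)
    (hh : ∀ i, h (i + 1) ≤ h i + 1 ∧ h i ≤ h (i + 1) + 1) (hmono : Monotone n)
    (hn : ∀ i, n (i + 1) ≤ n i + 1) (hN : h N = 0) (hKN : J * Δ ≤ n N) (hK : 1 ≤ J * Δ)
    (hL : 1 ≤ J * g) :
    ∃ i ≤ N, (∀ t < i, J * Δ ≤ n t → J * g < h t) ∧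
      ((h i ≤ 3 * (J * g) ∧ J * Δ ≤ n i ∧ n i ≤ 3 * (J * Δ)) ∨
        ∃ l' l, IsGrowthWindow h n J Δ g l' l i) := by
  classical
  have hflatN : IsFlatAt h n (J * Δ) (J * g) N := by
    obtain ⟨j, hj, hjv⟩ := exists_eq_of_step n0 hn (Nat.sub_le (n N) (J * Δ))
    exact ⟨j, hj, by omega, fun t _ _ => by omega⟩
  have hex : ∃ i, IsFlatAt h n (J * Δ) (J * g) i := ⟨N, hflatN⟩
  obtain ⟨i, hflat, hiN, hmin⟩ : ∃ i, IsFlatAt h n (J * Δ) (J * g) i ∧ i ≤ N ∧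
      ∀ t < i, ¬ IsFlatAt h n (J * Δ) (J * g) t :=
    ⟨Nat.find hex, Nat.find_spec hex, Nat.find_min' hex hflatN, fun t => Nat.find_min hex⟩
  have hJ : 1 ≤ J := Nat.pos_of_mul_pos_right hL
  have hKi : J * Δ ≤ n i := by obtain ⟨j, -, hj, -⟩ := hflat; omega
  refine ⟨i, hiN, fun t hti hKt => ?_, ?_⟩
  · obtain ⟨s, -, -, hs⟩ := exists_lt_of_not_isFlatAt n0 hmono hn (hmin t hti) hKt
    omega
  obtain ⟨i, rfl⟩ : ∃ m, i = m + 1 := Nat.exists_eq_add_one_of_ne_zero (by rintro rfl; omega)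
  have hdescent := exists_le_of_forall_not_isFlatAt n0 hmono hn (i := i) fun t hti =>
    hmin t (Nat.lt_succ_of_le hti)
  have hhi := hh i
  have hni := hn i
  have hni' := hmono i.le_succ
  simp only [Nat.succ_eq_add_one] at hni'
  by_cases hlow : h (i + 1) ≤ 3 * (J * g)
  · refine Or.inl ⟨hlow, hKi, ?_⟩
    by_contra! hc
    obtain ⟨s, -, -, hs⟩ := hdescent 3 (by omega)
    omega
  · obtain ⟨s, hsi, hs, hns⟩ : ∃ s ≤ i + 1, h s + 2 * (J * g) + 1 ≤ h (i + 1) ∧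
        n (i + 1) ≤ n s + 2 * (J * Δ) + 1 := by
      by_cases hKi' : 2 * (J * Δ) ≤ n i
      · obtain ⟨s, hsi, hns, hs⟩ := hdescent 2 hKi'
        exact ⟨s, by omega, by omega, by omega⟩
      · exact ⟨0, by omega, by omega, by omega⟩
    exact Or.inr <|
      hflat.exists_isGrowthWindow h0 (fun i => (hh i).1) hmono hJ (by omega) hsi hs hns

end HeightProfile

section LongEdges

variable {V : Type*} [DecidableEq V] (G : SimpleGraph V)

/-- The number of pairs of adjacent vertices in `P × W`. -/
noncomputable def edgeCount (P W : Finset V) : ℕ :=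
  open Classical in (G.interedges P W).card

omit [DecidableEq V] in
lemma edgeCount_mono_right (P : Finset V) {W W' : Finset V} (h : W ⊆ W') :
    edgeCount G P W ≤ edgeCount G P W' := by
  classical
  exact Finset.card_le_card (SimpleGraph.interedges_mono G subset_rfl h)

lemma edgeCount_union_right_le (P W W' : Finset V) :
    edgeCount G P (W ∪ W') ≤ edgeCount G P W + edgeCount G P W' := by
  classical
  unfold edgeCount SimpleGraph.interedges Rel.interedges
  rw [Finset.product_union, Finset.filter_union]
  exact Finset.card_union_le _ _

omit [DecidableEq V] in
lemma edgeCount_le_card {P W : Finset V} {S : Finset (Sym2 V)} (hPW : Disjoint P W)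
    (h : ∀ x ∈ P, ∀ y ∈ W, G.Adj x y → s(x, y) ∈ S) : edgeCount G P W ≤ S.card := by
  classical
  refine Finset.card_le_card_of_injOn (fun x => s(x.1, x.2)) ?_ ?_
  · intro x hx
    obtain ⟨hP, hW, hadj⟩ := (SimpleGraph.mem_interedges_iff G).1 hx
    exact h _ hP _ hW hadj
  · intro x hx y hy hxy
    obtain ⟨hxP, -, -⟩ := (SimpleGraph.mem_interedges_iff G).1 hx
    obtain ⟨-, hyW, -⟩ := (SimpleGraph.mem_interedges_iff G).1 hy
    rcases Sym2.eq_iff.1 hxy with ⟨h₁, h₂⟩ | ⟨h₁, -⟩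
    · exact Prod.ext h₁ h₂
    · exact absurd hyW (h₁ ▸ Finset.disjoint_left.1 hPW hxP)

/-- All sets `P ⊆ U` of size about `K` send at least `D * |P|` edges to `U`, even if the edges to
any `5 * Δ` vertices are ignored; if no edges are ignored, this holds down to size `Δ`. -/
def ExpandsRobustly (U : Finset V) (K Δ : ℕ) (D : ℝ) : Prop :=
  ∀ P Y : Finset V, P ⊆ Y → Y ⊆ U → (Y \ P).card ≤ 5 * Δ → P.card ≤ 4 * K →
    (K ≤ 2 * P.card ∨ (Y = P ∧ Δ ≤ P.card)) → D * P.card ≤ edgeCount G P (U \ Y)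

variable [Fintype G.edgeSet]

/-- The edges of `G` whose ends are joined by a path of length at least `g` in the graph with edge
set `F`. -/
noncomputable def longEdges (F : Finset (Sym2 V)) (g : ℕ) : Finset (Sym2 V) :=
  open Classical in G.edgeFinset.filter fun e => ∃ x y, e = s(x, y) ∧
    ∃ w : (fromEdgeSet (F : Set (Sym2 V))).Walk x y, w.IsPath ∧ g ≤ w.length

variable (F : Finset (Sym2 V)) (U : Finset V)

/-- The vertices discovered by the depth first search between the times `l` and `i`. -/
noncomputable def discovered (l i : ℕ) : Finset V :=
  (dfsState G F U l).unseen \ (dfsState G F U i).unseen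

/-- The depth first search has no bad window until it terminates. -/
def IsTypical (p β η : ℝ) : Prop :=
  ¬ ∃ i ≤ 2 * U.card + G.edgeFinset.card, ∃ j ≤ 2 * U.card + G.edgeFinset.card,
    (dfs G).BadWindow p β η F ⟨[], U, ∅⟩ i j

variable {G F U}

lemma card_discovered_add {l i : ℕ} (hli : l ≤ i) :
    (discovered G F U l i).card + (dfsState G F U i).unseen.card =
      (dfsState G F U l).unseen.card :=
  Finset.card_sdiff_add_card_eq_card (unseen_antitone F U hli)

lemma card_discovered_zero_add {l i : ℕ} (hli : l ≤ i) :
    (discovered G F U 0 l).card + (discovered G F U l i).card = (discovered G F U 0 i).card := by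
  have hl := card_discovered_add (G := G) (F := F) (U := U) l.zero_le
  have hi := card_discovered_add (G := G) (F := F) (U := U) i.zero_le
  have hli := card_discovered_add (G := G) (F := F) (U := U) hli
  omega

lemma sdiff_discovered_zero (i : ℕ) :
    U \ discovered G F U 0 i = (dfsState G F U i).unseen :=
  Finset.sdiff_sdiff_eq_self (dfsState_invariant F U i).unseen_subset

lemma discovered_subset (l i : ℕ) : discovered G F U l i ⊆ U :=
  Finset.sdiff_subset.trans (dfsState_invariant F U l).unseen_subset

lemma edgeCount_unseen_le_queries {P : Finset V} {l i : ℕ} (hli : l ≤ i)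
    (hP : P ⊆ discovered G F U l i) (hstack : ∀ x ∈ P, x ∉ (dfsState G F U i).stack) :
    edgeCount G P (dfsState G F U i).unseen ≤ (dfs G).queries F ⟨[], U, ∅⟩ l i := by
  rw [← (dfs G).card_asked_run_sdiff F _ hli]
  refine edgeCount_le_card G
    (Finset.disjoint_left.2 fun x hx => (Finset.mem_sdiff.1 (hP hx)).2) fun x hx y hy hxy => ?_
  obtain ⟨hxl, hxi⟩ := Finset.mem_sdiff.1 (hP hx)
  exact Finset.mem_sdiff.2
    ⟨(dfsState_invariant F U i).mem_asked x (discovered_subset l i (hP hx)) hxi (hstack x hx) y hy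
      hxy, (dfsState_invariant F U l).notMem_asked x hxl y (unseen_antitone F U hli hy)⟩

variable {p β η : ℝ}

lemma IsTypical.mul_edgeCount_unseen_lt (h : IsTypical G F U p β η) (hp : 0 ≤ p) (hβ : 0 ≤ β)
    {P : Finset V} {l i : ℕ} (hli : l ≤ i) (hi : i ≤ 2 * U.card + G.edgeFinset.card)
    (hP : P ⊆ discovered G F U l i) (hstack : ∀ x ∈ P, x ∉ (dfsState G F U i).stack) :
    p * edgeCount G P (dfsState G F U i).unseen < (1 + β) * (discovered G F U l i).card + η := by
  have hwindow : p * (dfs G).queries F ⟨[], U, ∅⟩ l i <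
      (1 + β) * (dfs G).positives F ⟨[], U, ∅⟩ l i + η :=
    not_le.1 fun hbad => h ⟨l, hli.trans hi, i, hi, hbad⟩
  have hpos : (dfs G).positives F ⟨[], U, ∅⟩ l i ≤ (discovered G F U l i).card := by
    have hcard := card_discovered_add (G := G) (F := F) (U := U) hli
    have hle := card_unseen_add_positives_le (G := G) F U hli
    omega
  calc p * edgeCount G P (dfsState G F U i).unseen
      ≤ p * (dfs G).queries F ⟨[], U, ∅⟩ l i := by
        gcongr
        exact edgeCount_unseen_le_queries hli hP hstack
    _ < (1 + β) * (dfs G).positives F ⟨[], U, ∅⟩ l i + η := hwindow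
    _ ≤ (1 + β) * (discovered G F U l i).card + η := by gcongr

variable {K Δ L : ℕ} {D : ℝ}

lemma IsTypical.card_discovered_lt_of_stack_eq_nil (h : IsTypical G F U p β η)
    (hexp : ExpandsRobustly G U K Δ D) (hp : 0 ≤ p) (hβ : 0 ≤ β)
    (hnum : ∀ q : ℝ, Δ ≤ q → (1 + β) * q + η < p * (D * q)) {t : ℕ}
    (ht : t ≤ 2 * U.card + G.edgeFinset.card) (hnil : (dfsState G F U t).stack = [])
    (hK : (discovered G F U 0 t).card ≤ 4 * K) : (discovered G F U 0 t).card < Δ := by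
  by_contra! hΔ
  have hedges := hexp _ _ subset_rfl (discovered_subset 0 t) (by simp) hK (Or.inr ⟨rfl, hΔ⟩)
  rw [sdiff_discovered_zero] at hedges
  have hlt := h.mul_edgeCount_unseen_lt hp hβ t.zero_le ht subset_rfl (by simp [hnil])
  have hge := hnum (discovered G F U 0 t).card (by exact_mod_cast hΔ)
  have hmul := mul_le_mul_of_nonneg_left hedges hp
  linarith

lemma IsTypical.exists_mul_lt_of_stack_length_le (h : IsTypical G F U p β η)
    (hexp : ExpandsRobustly G U K Δ D) (hp : 0 ≤ p) (hβ : 0 ≤ β) (hLΔ : 3 * L ≤ 5 * Δ)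
    (hLK : 6 * L ≤ K) {i : ℕ} (hi : i ≤ 2 * U.card + G.edgeFinset.card)
    (hlen : (dfsState G F U i).stack.length ≤ 3 * L) (hK : K ≤ (discovered G F U 0 i).card)
    (hK' : (discovered G F U 0 i).card ≤ 4 * K) :
    ∃ m : ℕ, K ≤ 2 * m ∧ p * (D * m) < (1 + β) * (m + 3 * L) + η := by
  set S := (dfsState G F U i).stack.toFinset
  set P := discovered G F U 0 i \ S
  have hS : S.card ≤ 3 * L := (List.toFinset_card_le _).trans hlen
  have hP : (discovered G F U 0 i).card ≤ P.card + S.card := by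
    rw [← tsub_le_iff_right]
    exact Finset.le_card_sdiff _ _
  have hYP : (discovered G F U 0 i \ P).card ≤ S.card :=
    Finset.card_le_card (by rw [sdiff_sdiff_right_self]; exact Finset.inter_subset_right)
  have hPle : P.card ≤ (discovered G F U 0 i).card := Finset.card_le_card Finset.sdiff_subset
  have hedges := hexp P _ Finset.sdiff_subset (discovered_subset 0 i) (by omega) (by omega)
    (Or.inl (by omega))
  rw [sdiff_discovered_zero] at hedges
  refine ⟨P.card, by omega, ?_⟩
  calc p * (D * P.card) ≤ p * edgeCount G P (dfsState G F U i).unseen := by gcongr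
    _ < (1 + β) * (discovered G F U 0 i).card + η :=
        h.mul_edgeCount_unseen_lt hp hβ i.zero_le hi Finset.sdiff_subset fun x hx hxS =>
          (Finset.mem_sdiff.1 hx).2 (List.mem_toFinset.2 hxS)
    _ ≤ (1 + β) * (P.card + 3 * L) + η := by
        gcongr
        exact_mod_cast hP.trans (by omega)

lemma card_discovered_zero_mono : Monotone fun i => (discovered G F U 0 i).card :=
  fun _ _ hij => Nat.le_of_add_right_le (card_discovered_zero_add (G := G) hij).le

lemma card_discovered_zero_succ_le (i : ℕ) :
    (discovered G F U 0 (i + 1)).card ≤ (discovered G F U 0 i).card + 1 := by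
  have hi := card_discovered_add (G := G) (F := F) (U := U) i.zero_le
  have hi' := card_discovered_add (G := G) (F := F) (U := U) (i + 1).zero_le
  have hle := (dfsState_step (G := G) F U i).card_unseen_le
  omega

variable {J g r l' l i : ℕ}

lemma IsGrowthWindow.edgeCount_le_card_longEdges
    (hw : IsGrowthWindow (fun i => (dfsState G F U i).stack.length)
      (fun i => (discovered G F U 0 i).card) J Δ g l' l i)
    (hrl : r ≤ l') (hr : ∀ t, r < t → t ≤ l' → (dfsState G F U t).stack ≠ []) {P : Finset V}
    (hP : P ⊆ discovered G F U l i) :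
    edgeCount G P (discovered G F U r l') ≤ (longEdges G F g).card := by
  classical
  refine edgeCount_le_card G (Finset.disjoint_left.2 fun x hx hx' => ?_) fun x hx y hy hxy => ?_
  · exact (Finset.mem_sdiff.1 hx').2 (unseen_antitone F U hw.le (Finset.mem_sdiff.1 (hP hx)).1)
  · obtain ⟨hxl, hxi⟩ := Finset.mem_sdiff.1 (hP hx)
    obtain ⟨hyr, hyl⟩ := Finset.mem_sdiff.1 hy
    obtain ⟨j, rest, hlj, hji, hj⟩ := exists_discovery hw.lt.le hxl hxi
    have hnil : (dfsState G F U l').stack ≠ [] := List.ne_nil_of_length_pos hw.height_pos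
    have hlen := hw.height_eq ▸ hw.height_lt j hlj hji
    obtain ⟨w, hw, hwlen⟩ := exists_long_path hrl hr hnil hyr hyl (hw.le.trans hlj.le)
      (fun t hl't htj => hw.le_height t hl't (htj.trans hji)) hj (by omega)
    exact Finset.mem_filter.2
      ⟨SimpleGraph.mem_edgeFinset.2 hxy, x, y, rfl, w, hw, by omega⟩

lemma IsGrowthWindow.card_discovered_inter_stack_le
    (hw : IsGrowthWindow (fun i => (dfsState G F U i).stack.length)
      (fun i => (discovered G F U 0 i).card) J Δ g l' l i) :
    (discovered G F U l i ∩ (dfsState G F U i).stack.toFinset).card ≤ 2 * (J * g) + 1 := by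
  obtain ⟨A, hA, -⟩ := exists_stack_eq_append hw.lt.le fun t hlt hti =>
    hlt.eq_or_lt.elim (fun heq => heq ▸ le_rfl) fun hlt => (hw.height_lt t hlt hti).le
  have hsub : discovered G F U l i ∩ (dfsState G F U i).stack.toFinset ⊆ A.toFinset := by
    intro x hx
    obtain ⟨hx, hxi⟩ := Finset.mem_inter.1 hx
    rw [hA, List.mem_toFinset, List.mem_append] at hxi
    exact List.mem_toFinset.2 <| hxi.resolve_right fun hxl =>
      (dfsState_invariant F U l).stack_notMem_unseen x hxl (Finset.mem_sdiff.1 hx).1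
  have hlen := hw.height_le_add
  simp only [hA, List.length_append] at hlen
  exact (Finset.card_le_card hsub).trans ((List.toFinset_card_le A).trans (by omega))

lemma IsGrowthWindow.edgeCount_sdiff_le
    (hw : IsGrowthWindow (fun i => (dfsState G F U i).stack.length)
      (fun i => (discovered G F U 0 i).card) J Δ g l' l i)
    (hrl : r ≤ l') (hr : ∀ t, r < t → t ≤ l' → (dfsState G F U t).stack ≠ []) {P : Finset V}
    (hP : P ⊆ discovered G F U l i) :
    edgeCount G P (U \ (discovered G F U l' i ∪ discovered G F U 0 r)) ≤
      edgeCount G P (dfsState G F U i).unseen + (longEdges G F g).card := by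
  have hsub : U \ (discovered G F U l' i ∪ discovered G F U 0 r) ⊆
      (dfsState G F U i).unseen ∪ discovered G F U r l' := by
    intro v hv
    rw [Finset.sdiff_union_distrib, sdiff_discovered_zero] at hv
    simp only [discovered, Finset.mem_sdiff, Finset.mem_inter, Finset.mem_union] at hv ⊢
    tauto
  exact (edgeCount_mono_right G P hsub).trans <| (edgeCount_union_right_le G P _ _).trans <|
    Nat.add_le_add_left (hw.edgeCount_le_card_longEdges hrl hr hP) _

lemma IsTypical.exists_mul_lt_of_isGrowthWindow (h : IsTypical G F U p β η)
    (hexp : ExpandsRobustly G U (J * Δ) Δ D) (hp : 0 ≤ p) (hβ : 0 ≤ β)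
    (hLΔ : 2 * (J * g) + 2 ≤ 3 * Δ) (hLK : 6 * (J * g) + 2 ≤ J * Δ)
    (hi : i ≤ 2 * U.card + G.edgeFinset.card)
    (hw : IsGrowthWindow (fun i => (dfsState G F U i).stack.length)
      (fun i => (discovered G F U 0 i).card) J Δ g l' l i)
    (hrl : r ≤ l') (hr : ∀ t, r < t → t ≤ l' → (dfsState G F U t).stack ≠ [])
    (hrΔ : (discovered G F U 0 r).card < Δ) :
    ∃ m : ℕ, J * Δ ≤ 2 * m ∧ p * (D * m) <
      (1 + β) * (m + 2 * (J * g : ℕ) + 1) + η + p * (longEdges G F g).card := by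
  obtain ⟨hl'l, hli, hKn, hnK, hshort, -⟩ := id hw
  set S := (dfsState G F U i).stack.toFinset
  set P := discovered G F U l i \ S
  set Y := discovered G F U l' i ∪ discovered G F U 0 r
  have hS : (discovered G F U l i ∩ S).card ≤ 2 * (J * g) + 1 := hw.card_discovered_inter_stack_le
  have hP : P.card + (discovered G F U l i ∩ S).card = (discovered G F U l i).card :=
    Finset.card_sdiff_add_card_inter _ _
  have hl := card_discovered_zero_add (G := G) (F := F) (U := U) hli.le
  have hl' := card_discovered_zero_add (G := G) (F := F) (U := U) (hl'l.trans hli.le)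
  have hPl' : P ⊆ discovered G F U l' i := Finset.sdiff_subset.trans <|
    Finset.sdiff_subset_sdiff (unseen_antitone F U hl'l) subset_rfl
  have hYP : (Y \ P).card ≤ 5 * Δ := by
    have hunion : (Y \ P).card ≤ (discovered G F U l' i \ P).card +
        (discovered G F U 0 r).card := by
      rw [Finset.union_sdiff_distrib]
      exact (Finset.card_union_le _ _).trans
        (Nat.add_le_add_left (Finset.card_le_card Finset.sdiff_subset) _)
    rw [Finset.card_sdiff_of_subset hPl'] at hunion
    omega
  have hedges := hexp P Y (hPl'.trans Finset.subset_union_left)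
    (Finset.union_subset (discovered_subset l' i) (discovered_subset 0 r)) hYP (by omega)
    (Or.inl (by omega))
  have hunseen := h.mul_edgeCount_unseen_lt hp hβ hli.le hi (P := P) Finset.sdiff_subset
    fun x hx hxS => (Finset.mem_sdiff.1 hx).2 (List.mem_toFinset.2 hxS)
  refine ⟨P.card, by omega, ?_⟩
  calc p * (D * P.card)
      ≤ p * ((edgeCount G P (dfsState G F U i).unseen + (longEdges G F g).card : ℕ) : ℝ) := by
        gcongr
        exact hedges.trans (Nat.cast_le.2 (hw.edgeCount_sdiff_le hrl hr Finset.sdiff_subset))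
    _ < (1 + β) * (discovered G F U l i).card + η + p * (longEdges G F g).card := by
        rw [Nat.cast_add, mul_add]
        gcongr
    _ ≤ (1 + β) * (P.card + 2 * (J * g : ℕ) + 1) + η + p * (longEdges G F g).card := by
        gcongr
        exact_mod_cast (by omega)

/-- Unless the search finds many long edges, the edges that leave a suitable set of processed
vertices are too many to be answered negatively. -/
theorem IsTypical.exists_mul_lt (h : IsTypical G F U p β η)
    (hexp : ExpandsRobustly G U (J * Δ) Δ D) (hp : 0 ≤ p) (hβ : 0 ≤ β) (hL : 1 ≤ J * g)
    (hLΔ : 2 * (J * g) + 2 ≤ 3 * Δ) (hLK : 6 * (J * g) + 2 ≤ J * Δ) (hKU : J * Δ ≤ U.card)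
    (hnum : ∀ q : ℝ, Δ ≤ q → (1 + β) * q + η < p * (D * q)) :
    ∃ m : ℕ, J * Δ ≤ 2 * m ∧ p * (D * m) <
      (1 + β) * (m + 3 * (J * g : ℕ)) + η + p * (longEdges G F g).card := by
  set N := 2 * U.card + G.edgeFinset.card with hN
  set ht : ℕ → ℕ := fun i => (dfsState G F U i).stack.length
  set n : ℕ → ℕ := fun i => (discovered G F U 0 i).card
  have hht0 : ht 0 = 0 := by simp [ht, dfsState, Exploration.run]
  have hhts (i : ℕ) : ht (i + 1) ≤ ht i + 1 ∧ ht i ≤ ht (i + 1) + 1 :=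
    ⟨(dfsState_step F U i).length_stack_le, (dfsState_step F U i).le_length_stack⟩
  obtain ⟨hnil, hempty⟩ := dfsState_of_le (G := G) F U hN.ge
  have hnN : n N = U.card := by
    rw [← sdiff_discovered_zero, Finset.sdiff_eq_empty_iff_subset] at hempty
    exact congrArg Finset.card ((discovered_subset 0 N).antisymm hempty)
  obtain ⟨i, hiN, hhigh, hlow | ⟨l', l, hw⟩⟩ := exists_isGrowthWindow_or_height_le hht0
    (by simp [discovered]) hhts card_discovered_zero_mono card_discovered_zero_succ_le
    (by simp [ht, hnil]) (hnN ▸ hKU) (by omega) hL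
  · obtain ⟨hlen, hK, hK'⟩ := hlow
    obtain ⟨m, hm, hlt⟩ := h.exists_mul_lt_of_stack_length_le hexp hp hβ (by omega) (by omega) hiN
      hlen hK (hK'.trans (by omega))
    exact ⟨m, hm, hlt.trans_le (le_add_of_nonneg_right (by positivity))⟩
  · have hr : ht (lastVisit ht l' 0) = 0 := Nat.le_zero.1 (height_lastVisit_le hht0 l' 0)
    have hrl : lastVisit ht l' 0 < l' := lastVisit_lt hht0 hw.height_pos
    have hri := hrl.trans_le (hw.le.trans hw.lt.le)
    have hrK : n (lastVisit ht l' 0) < J * Δ := by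
      by_contra! hK
      exact absurd (hhigh _ hri hK) (by omega)
    obtain ⟨m, hm, hlt⟩ := h.exists_mul_lt_of_isGrowthWindow hexp hp hβ hLΔ hLK hiN hw hrl.le
      (fun t hrt htl => List.ne_nil_of_length_pos (lt_height_of_lastVisit_lt hrt htl))
      (h.card_discovered_lt_of_stack_eq_nil hexp hp hβ hnum (hri.le.trans hiN)
        (List.eq_nil_of_length_eq_zero hr) (hrK.le.trans (by omega)))
    refine ⟨m, hm, hlt.trans_le ?_⟩
    gcongr ?_ + _ + _
    rw [add_assoc (m : ℝ)]
    gcongr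
    exact_mod_cast (by omega)

end LongEdges

section Reservoir

variable {V : Type*} [Fintype V] {G : SimpleGraph V}

lemma mem_extNbhd {S : Finset V} {v : V} : v ∈ extNbhd G S ↔ v ∉ S ∧ ∃ u ∈ S, G.Adj u v := by
  classical
  simp [extNbhd]

lemma extNbhd_empty : extNbhd G ∅ = ∅ := by
  ext v
  simp [mem_extNbhd]

variable [DecidableEq V]

lemma card_extNbhd_union_le (X Z : Finset V) :
    (extNbhd G (X ∪ Z)).card ≤ (extNbhd G X).card + (extNbhd G Z \ X).card := by
  refine (Finset.card_le_card fun v hv => ?_).trans (Finset.card_union_le _ _)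
  simp only [Finset.mem_union, Finset.mem_sdiff, mem_extNbhd, not_or] at hv ⊢
  obtain ⟨⟨hvX, hvZ⟩, u, hu | hu, huv⟩ := hv
  · exact Or.inl ⟨hvX, u, hu, huv⟩
  · exact Or.inr ⟨⟨hvZ, u, hu, huv⟩, hvX⟩

lemma card_extNbhd_sdiff_le_of_subset {Z₀ Z : Finset V} (hZ : Z₀ ⊆ Z) (X : Finset V) :
    (extNbhd G Z₀ \ X).card ≤ (extNbhd G Z \ X).card + Z.card := by
  refine (Finset.card_le_card fun v hv => ?_).trans (Finset.card_union_le _ _)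
  simp only [Finset.mem_union, Finset.mem_sdiff, mem_extNbhd] at hv ⊢
  obtain ⟨⟨-, u, hu, huv⟩, hvX⟩ := hv
  by_cases hvZ : v ∈ Z
  · exact Or.inr hvZ
  · exact Or.inl ⟨⟨hvZ, u, hZ hu, huv⟩, hvX⟩

variable (G) in
/-- Sets of at most `r` vertices outside `X` expand by the factor `D`, not counting neighbours
in `X`. -/
def ExpandsOutside (X : Finset V) (r : ℕ) (D : ℝ) : Prop :=
  ∀ Z : Finset V, Disjoint X Z → Z.card ≤ r → D * Z.card ≤ (extNbhd G Z \ X).card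

variable (G) in
/-- The witness minimises `|N(S)| - φ |S|` among the sets of size at most `k`. -/
lemma exists_forall_sub_le_card_extNbhd_sdiff (φ : ℕ → ℝ) (k : ℕ) :
    ∃ X : Finset V, X.card ≤ k ∧ (extNbhd G X).card ≤ φ X.card - φ 0 ∧
      ∀ Z : Finset V, Disjoint X Z → X.card + Z.card ≤ k →
        φ (X.card + Z.card) - φ X.card ≤ (extNbhd G Z \ X).card := by
  classical
  obtain ⟨X, hX, hmin⟩ := Finset.exists_min_image
    ((Finset.univ : Finset (Finset V)).filter fun S => S.card ≤ k)
    (fun S => ((extNbhd G S).card : ℝ) - φ S.card) ⟨∅, by simp⟩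
  simp only [Finset.mem_filter, Finset.mem_univ, true_and] at hX hmin
  refine ⟨X, hX, ?_, fun Z hXZ hZ => ?_⟩
  · have hle := hmin ∅ (by simp)
    rw [extNbhd_empty, Finset.card_empty, Nat.cast_zero] at hle
    linarith
  · have hcard := Finset.card_union_of_disjoint hXZ
    have hle := hmin (X ∪ Z) (hcard.trans_le hZ)
    have hunion : ((extNbhd G (X ∪ Z)).card : ℝ) ≤ (extNbhd G X).card + (extNbhd G Z \ X).card := by
      exact_mod_cast card_extNbhd_union_le X Z
    rw [hcard] at hle
    linarith

lemma div_two_mul_sqrt_le {r z : ℝ} (hr : 0 < r) (hzr : z ≤ r) :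
    z / (2 * √r) ≤ √r - √(r - z) := by
  rw [div_le_iff₀ (mul_pos two_pos (Real.sqrt_pos.2 hr))]
  have hr2 := Real.sq_sqrt hr.le
  have hz2 := Real.sq_sqrt (sub_nonneg.2 hzr)
  nlinarith [sq_nonneg (√r - √(r - z))]

/-- A lower bound for `|N(S)|` as a function of `x = |S|`, which expanders satisfy at `x = k`. Its
slope is at least `(1 - 3 * ε / 8) * d` and increases to infinity at `k`. -/
noncomputable def expansionProfile (ε d k x : ℝ) : ℝ :=
  (1 - ε / 2) * d * x + ε / 4 * d * (k - √k * √(k - x))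

lemma expansionProfile_zero {k : ℝ} (hk : 0 ≤ k) (ε d : ℝ) : expansionProfile ε d k 0 = 0 := by
  simp [expansionProfile, Real.mul_self_sqrt hk]

lemma expansionProfile_le {ε d k x : ℝ} (hε0 : 0 ≤ ε) (hε1 : ε ≤ 1) (hd : 0 ≤ d) (hx : x ≤ k) :
    expansionProfile ε d k x ≤ (1 - ε / 4) * (d * k) := by
  have hlin : (1 - ε / 2) * d * x ≤ (1 - ε / 2) * d * k :=
    mul_le_mul_of_nonneg_left hx (mul_nonneg (by linarith) hd)
  have hsqrt : 0 ≤ ε / 4 * d * (√k * √(k - x)) := by positivity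
  unfold expansionProfile
  linarith

lemma mul_le_expansionProfile_sub {ε d k x z : ℝ} (hε : 0 ≤ ε) (hd : 0 ≤ d) (hxk : x < k)
    (hz : z ≤ k - x) :
    (1 - ε / 2 + ε / 8 * (√k / √(k - x))) * d * z ≤
      expansionProfile ε d k (x + z) - expansionProfile ε d k x := by
  have hsqrt := mul_le_mul_of_nonneg_left (div_two_mul_sqrt_le (sub_pos.2 hxk) hz)
    (by positivity : 0 ≤ ε / 4 * d * √k)
  unfold expansionProfile
  rw [sub_add_eq_sub_sub k]
  linear_combination hsqrt

variable {k d : ℕ} {ε : ℝ}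

lemma IsExpanderAt.exists_expandsOutside (hG : IsExpanderAt G k d) (hk : 1 ≤ k) (hd : 1 ≤ d)
    (hε : 0 < ε) (hε1 : ε ≤ 1) :
    ∃ X : Finset V, X.card < k ∧ (extNbhd G X).card ≤ (1 - ε / 4) * (d * k) ∧
      ExpandsOutside G X (k - X.card) ((1 - ε / 2 + ε / 8 * (√k / √(k - X.card : ℕ))) * d) := by
  have hdk : (0 : ℝ) < ε / 4 * (d * k) := by positivity
  obtain ⟨X, hX, hNX, hexp⟩ := exists_forall_sub_le_card_extNbhd_sdiff G
    (fun x : ℕ => expansionProfile ε d k x) k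
  simp only [Nat.cast_zero, expansionProfile_zero k.cast_nonneg, sub_zero, Nat.cast_add]
    at hNX hexp
  have hNX' := hNX.trans (expansionProfile_le hε.le hε1 d.cast_nonneg (Nat.cast_le.2 hX))
  have hXk : X.card < k := by
    refine hX.lt_of_ne fun heq => ?_
    have hle : (d * k : ℝ) ≤ (extNbhd G X).card := by exact_mod_cast heq ▸ hG X heq
    linarith
  refine ⟨X, hXk, hNX', fun Z hXZ hZ => ?_⟩
  refine le_trans ?_ (hexp Z hXZ (by omega))
  rw [Nat.cast_sub hX]
  refine mul_le_expansionProfile_sub hε.le d.cast_nonneg (Nat.cast_lt.2 hXk) ?_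
  exact_mod_cast (Nat.cast_le (α := ℝ)).2 hZ |>.trans (Nat.cast_sub hX).le

/-- Sets that are too large to be added to `X` contain a set which, together with `X`, has size
exactly `k`. -/
lemma ExpandsOutside.extend {X : Finset V} {D : ℝ} (hexp : ExpandsOutside G X (k - X.card) D)
    (hG : IsExpanderAt G k d) (hd : 1 ≤ d) (hε : 0 ≤ ε) (hX : X.card ≤ k)
    (hNX : (extNbhd G X).card ≤ (1 - ε / 4) * (d * k)) (hD : 2 * d ≤ D + ε / 2 * d) {r : ℕ}
    (hr : (r : ℝ) ≤ ε * k / 12) : ExpandsOutside G X r ((2 - ε / 2) * d) := by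
  intro Z hXZ hZ
  rcases le_total Z.card (k - X.card) with hZk | hZk
  · refine le_trans ?_ (hexp Z hXZ hZk)
    gcongr
    linarith
  obtain ⟨Z₀, hZ₀, hZ₀k⟩ := Finset.exists_subset_card_eq hZk
  have hcard : (X ∪ Z₀).card = k := by
    rw [Finset.card_union_of_disjoint (Finset.disjoint_of_subset_right hZ₀ hXZ), hZ₀k]
    omega
  have hcount : (d * k : ℝ) ≤ (extNbhd G X).card + ((extNbhd G Z \ X).card + Z.card) := by
    exact_mod_cast (hcard ▸ hG _ hcard : d * k ≤ _).trans <| (card_extNbhd_union_le X Z₀).trans <|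
      Nat.add_le_add_left (card_extNbhd_sdiff_le_of_subset hZ₀ X) _
  have hZr : (Z.card : ℝ) ≤ ε * k / 12 := (Nat.cast_le.2 hZ).trans hr
  have hdZ : (d : ℝ) * Z.card ≤ d * (ε * k / 12) := by gcongr
  have hZd : (Z.card : ℝ) ≤ d * Z.card :=
    le_mul_of_one_le_left (Nat.cast_nonneg _) (Nat.one_le_cast.2 hd)
  have hεZ : 0 ≤ ε / 2 * d * Z.card := by positivity
  linarith

theorem IsExpanderAt.exists_reservoir (hG : IsExpanderAt G k d) (hk : 1 ≤ k) (hd : 1 ≤ d)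
    (hε : 0 < ε) (hε1 : ε ≤ 1) :
    ∃ (X : Finset V) (r : ℕ) (e : ℝ), X.card < k ∧ 1 ≤ r ∧ r ≤ k ∧ ε / 8 ≤ e ∧ e ≤ 1 ∧
      ε ^ 2 * k / 128 ≤ e ^ 2 * r ∧ ExpandsOutside G X r ((1 - ε / 2 + e) * d) := by
  obtain ⟨X, hXk, hNX, hexp⟩ := hG.exists_expandsOutside hk hd hε hε1
  set r := k - X.card
  set e := ε / 8 * (√k / √r) with he
  have hr0 : (0 : ℝ) < r := by exact_mod_cast Nat.sub_pos_of_lt hXk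
  have hεk : 0 ≤ ε ^ 2 * k := by positivity
  have her : e ^ 2 * r = ε ^ 2 * k / 64 := by
    rw [he, mul_pow, div_pow (√(k : ℝ)), Real.sq_sqrt k.cast_nonneg, Real.sq_sqrt hr0.le]
    field_simp
    norm_num
  by_cases he1 : e ≤ 1
  · refine ⟨X, r, e, hXk, Nat.sub_pos_of_lt hXk, Nat.sub_le _ _, ?_, he1, by linarith, hexp⟩
    refine le_mul_of_one_le_right (by positivity) ?_
    rw [one_le_div (Real.sqrt_pos.2 hr0)]
    exact Real.sqrt_le_sqrt (Nat.cast_le.2 (Nat.sub_le _ _))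
  · push Not at he1
    have hrε : r ≤ ε ^ 2 * k / 64 := her ▸ le_mul_of_one_le_left hr0.le (one_le_pow₀ he1.le)
    have hfloor : (⌊ε ^ 2 * k / 64⌋₊ : ℝ) ≤ ε ^ 2 * k / 64 := Nat.floor_le (by positivity)
    have hlt := Nat.lt_floor_add_one (ε ^ 2 * k / 64)
    have hr1 : 1 ≤ ⌊ε ^ 2 * k / 64⌋₊ := (Nat.sub_pos_of_lt hXk).trans_le (Nat.le_floor hrε)
    have hr1' : (1 : ℝ) ≤ ⌊ε ^ 2 * k / 64⌋₊ := Nat.one_le_cast.2 hr1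
    have hε2k : ε ^ 2 * k ≤ ε * k :=
      mul_le_mul_of_nonneg_right (by nlinarith) k.cast_nonneg
    have hεk' : ε * k ≤ k := mul_le_of_le_one_left k.cast_nonneg hε1
    have h2 : (1 - ε / 2 + 1) * (d : ℝ) = (2 - ε / 2) * d := by ring
    refine ⟨X, ⌊ε ^ 2 * k / 64⌋₊, 1, hXk, hr1, ?_, by linarith, le_rfl, by linarith, ?_⟩
    · exact_mod_cast (by linarith : (⌊ε ^ 2 * k / 64⌋₊ : ℝ) ≤ k)
    · rw [h2]
      refine hexp.extend hG hd hε.le hXk.le hNX ?_ (by linarith)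
      have := mul_le_mul_of_nonneg_right he1.le (d.cast_nonneg : (0 : ℝ) ≤ d)
      linarith

end Reservoir

section RobustExpansion

variable {V : Type*} [Fintype V] [DecidableEq V] {G : SimpleGraph V}

lemma card_extNbhd_sdiff_le_edgeCount_add (P X Y : Finset V) :
    (extNbhd G P \ X).card ≤ edgeCount G P (Xᶜ \ Y) + (Y \ P).card := by
  classical
  have hsub : extNbhd G P \ X ⊆ (G.interedges P (Xᶜ \ Y)).image Prod.snd ∪ (Y \ P) := by
    intro v hv
    obtain ⟨hv, hvX⟩ := Finset.mem_sdiff.1 hv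
    obtain ⟨hvP, u, hu, huv⟩ := mem_extNbhd.1 hv
    by_cases hvY : v ∈ Y
    · exact Finset.mem_union_right _ (Finset.mem_sdiff.2 ⟨hvY, hvP⟩)
    · refine Finset.mem_union_left _ (Finset.mem_image.2 ⟨(u, v), ?_, rfl⟩)
      simp [SimpleGraph.mem_interedges_iff, hu, huv, hvX, hvY]
  exact (Finset.card_le_card hsub).trans <| (Finset.card_union_le _ _).trans <|
    Nat.add_le_add_right Finset.card_image_le _

omit [Fintype V] in
lemma edgeCount_add_edgeCount_sdiff {P Q : Finset V} (hQP : Q ⊆ P) (W : Finset V) :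
    edgeCount G Q W + edgeCount G (P \ Q) W = edgeCount G P W := by
  classical
  unfold edgeCount
  rw [← Finset.card_union_of_disjoint
    (SimpleGraph.interedges_disjoint_left G Finset.disjoint_sdiff W)]
  congr 1
  ext ⟨x, y⟩
  simp only [Finset.mem_union, SimpleGraph.mem_interedges_iff, Finset.mem_sdiff]
  have := @hQP x
  tauto

variable {X P Y : Finset V} {r : ℕ} {D δ : ℝ}

lemma ExpandsOutside.mul_card_le_edgeCount (hexp : ExpandsOutside G X r (D + δ)) (hPY : P ⊆ Y)
    (hXY : Disjoint X Y) (hP : P.card ≤ r) (hY : (Y \ P).card ≤ δ * P.card) :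
    D * P.card ≤ edgeCount G P (Xᶜ \ Y) := by
  have hN := hexp P (Finset.disjoint_of_subset_right hPY hXY) hP
  have hcount : ((extNbhd G P \ X).card : ℝ) ≤ edgeCount G P (Xᶜ \ Y) + (Y \ P).card := by
    exact_mod_cast card_extNbhd_sdiff_le_edgeCount_add P X Y
  linarith

/-- Large sets are cut into pieces with between `r / 2` and `r` vertices. -/
lemma ExpandsOutside.mul_card_le_edgeCount_of_le_card (hexp : ExpandsOutside G X r (D + δ))
    (hr : 1 ≤ r) (hδ : 0 ≤ δ) (hPY : P ⊆ Y) (hXY : Disjoint X Y) (hrP : r ≤ 2 * P.card)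
    (hY : Y.card ≤ δ / 2 * r) : D * P.card ≤ edgeCount G P (Xᶜ \ Y) := by
  have hpiece : ∀ Q ⊆ Y, Q.card ≤ r → r ≤ 2 * Q.card →
      D * Q.card ≤ edgeCount G Q (Xᶜ \ Y) := fun Q hQY hQr hrQ => by
    refine hexp.mul_card_le_edgeCount hQY hXY hQr ?_
    calc ((Y \ Q).card : ℝ) ≤ Y.card := Nat.cast_le.2 (Finset.card_le_card Finset.sdiff_subset)
      _ ≤ δ / 2 * (2 * Q.card : ℕ) := hY.trans (by gcongr)
      _ = δ * Q.card := by push_cast; ring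
  induction P using Finset.strongInduction with
  | _ P ih =>
    rcases le_or_gt P.card r with hPr | hPr
    · exact hpiece P hPY hPr hrP
    · obtain ⟨Q, hQP, hQ⟩ := Finset.exists_subset_card_eq (by omega : (r + 1) / 2 ≤ P.card)
      have hsdiff : (P \ Q).card = P.card - Q.card := Finset.card_sdiff_of_subset hQP
      have hQne : Q.Nonempty := Finset.card_pos.1 (by omega)
      have hrest := ih (P \ Q) (Finset.sdiff_ssubset hQP hQne)
        (Finset.sdiff_subset.trans hPY) (by omega)
      have hQedges := hpiece Q (hQP.trans hPY) (by omega) (by omega)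
      have hcard : (P.card : ℝ) = (P \ Q).card + Q.card := by
        exact_mod_cast (Finset.card_sdiff_add_card_eq_card hQP).symm
      rw [← edgeCount_add_edgeCount_sdiff hQP, hcard]
      push_cast
      linarith

lemma ExpandsOutside.expandsRobustly {J Δ : ℕ} (hexp : ExpandsOutside G X r (D + δ))
    (hr : 1 ≤ r) (hδ : 0 ≤ δ) (hΔ : Δ ≤ δ * r / 320) (hrJ : r ≤ 16 * (J * Δ))
    (hJ : 8 * (J * Δ) ≤ r ∨ J = 1) : ExpandsRobustly G Xᶜ (J * Δ) Δ D := by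
  intro P Y hPY hYX hYP hP hcase
  have hXY : Disjoint X Y := Finset.disjoint_right.2 fun v hv => Finset.mem_compl.1 (hYX hv)
  have hδr : 0 ≤ δ * r := by positivity
  rcases le_or_gt P.card r with hPr | hPr
  · refine hexp.mul_card_le_edgeCount hPY hXY hPr ?_
    rcases hcase with hJP | ⟨rfl, -⟩
    · have hrP : δ * r ≤ δ * (32 * P.card : ℕ) := by gcongr; omega
      have hYP' : ((Y \ P).card : ℝ) ≤ 5 * Δ := by exact_mod_cast hYP
      push_cast at hrP
      linarith
    · rw [Finset.sdiff_self, Finset.card_empty, Nat.cast_zero]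
      positivity
  · have hJ1 : J = 1 := hJ.resolve_left (by omega)
    refine hexp.mul_card_le_edgeCount_of_le_card hr hδ hPY hXY (by omega) ?_
    have hY : Y.card ≤ 9 * Δ := by
      have := Finset.card_sdiff_add_card_eq_card hPY
      rw [hJ1] at hP
      omega
    have hY' : (Y.card : ℝ) ≤ 9 * Δ := by exact_mod_cast hY
    linarith

omit [DecidableEq V] in
lemma IsExpanderAt.mul_add_le_card {k d : ℕ} (hG : IsExpanderAt G k d)
    (hk : k ≤ Fintype.card V) : d * k + k ≤ Fintype.card V := by
  classical
  obtain ⟨S, -, hS⟩ := Finset.exists_subset_card_eq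
    (by simpa using hk : k ≤ (Finset.univ : Finset V).card)
  have hN := hG S hS
  have hdisj : Disjoint (extNbhd G S) S :=
    Finset.disjoint_left.2 fun v hv => (mem_extNbhd.1 hv).1
  have huniv := Finset.card_le_univ (extNbhd G S ∪ S)
  rw [Finset.card_union_of_disjoint hdisj] at huniv
  rw [hS] at hN huniv
  omega

end RobustExpansion

section Parameters

lemma exists_mul_scale {Δ : ℕ} (hΔ : 0 < Δ) (r : ℕ) :
    ∃ J, 1 ≤ J ∧ r ≤ 16 * (J * Δ) ∧ (8 * (J * Δ) ≤ r ∨ J = 1) := by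
  have hdiv := Nat.div_add_mod r (16 * Δ)
  have hmod := Nat.mod_lt r (by omega : 0 < 16 * Δ)
  have hassoc : 16 * Δ * (r / (16 * Δ)) = 16 * (r / (16 * Δ) * Δ) := by ring
  refine ⟨r / (16 * Δ) + 1, Nat.le_add_left 1 _, by rw [add_one_mul]; omega, ?_⟩
  rcases Nat.eq_zero_or_pos (r / (16 * Δ)) with hq | hq
  · exact Or.inr (by rw [hq])
  · have := Nat.le_mul_of_pos_left Δ hq
    exact Or.inl (by rw [add_one_mul]; omega)

variable {e κ : ℝ}

lemma exists_scales {r d : ℕ} (hd : 2 ≤ d) (he0 : 0 < e) (he1 : e ≤ 1) (hκ : 10 ≤ κ)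
    (hκr : 122 * κ ≤ e ^ 2 * d * r / 640) :
    ∃ J Δ g : ℕ, 1 ≤ J ∧ κ ≤ g ∧ 100 * κ ≤ e * Δ ∧ 100 * g ≤ e * Δ ∧ Δ ≤ e * d * r / 640 ∧
      r ≤ 16 * (J * Δ) ∧ (8 * (J * Δ) ≤ r ∨ J = 1) ∧ 2 * (J * g) + 2 ≤ 3 * Δ := by
  set Δ := ⌊e * d * r / 640⌋₊
  set g := ⌊e * Δ / 100⌋₊
  have hΔle : Δ ≤ e * d * r / 640 := Nat.floor_le (by positivity)
  have hΔlt : e * d * r / 640 < Δ + 1 := Nat.lt_floor_add_one _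
  have hgle : g ≤ e * Δ / 100 := Nat.floor_le (by positivity)
  have hglt : e * Δ / 100 < g + 1 := Nat.lt_floor_add_one _
  have hκΔ : 121 * κ ≤ e * Δ := by
    have := mul_le_mul_of_nonneg_left hΔlt.le he0.le
    linarith
  have heΔ : e * Δ ≤ Δ := mul_le_of_le_one_left Δ.cast_nonneg he1
  have hΔ : 0 < Δ := by
    have : (0 : ℝ) < Δ := by linarith
    exact_mod_cast this
  obtain ⟨J, hJ, hrJ, hJr⟩ := exists_mul_scale hΔ r
  refine ⟨J, Δ, g, hJ, by linarith, by linarith, by linarith, hΔle, hrJ, hJr, ?_⟩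
  have hJg : (2 : ℝ) * (J * g) + 2 ≤ 3 * Δ := by
    rcases hJr with hJr | rfl
    · have hgJ : (J : ℝ) * g ≤ J * (e * Δ / 100) := by gcongr
      have hJr' : e * (8 * (J * Δ)) ≤ e * r :=
        mul_le_mul_of_nonneg_left (by exact_mod_cast hJr) he0.le
      have hdr : e * 2 * r ≤ e * d * r := by gcongr; exact_mod_cast hd
      linarith
    · rw [Nat.cast_one]
      linarith
  exact_mod_cast hJg

variable {V : Type*} [DecidableEq V] {G : SimpleGraph V} [Fintype G.edgeSet]
  {F : Finset (Sym2 V)}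

lemma IsTypical.div_lt_card_longEdges {U : Finset V} {J Δ g : ℕ} {p β D : ℝ}
    (h : IsTypical G F U p β κ) (hexp : ExpandsRobustly G U (J * Δ) Δ D) (hp : 0 < p)
    (hβ0 : 0 ≤ β) (hβe : β ≤ e / 8) (he1 : e ≤ 1) (hpD : 1 + e / 2 ≤ p * D) (hJ : 1 ≤ J)
    (hκ : 10 ≤ κ) (hκg : κ ≤ g) (hκΔ : 100 * κ ≤ e * Δ) (hgΔ : 100 * g ≤ e * Δ)
    (hLΔ : 2 * (J * g) + 2 ≤ 3 * Δ) (hJU : J * Δ ≤ U.card) :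
    κ / p < (longEdges G F g).card := by
  have he0 : 0 ≤ e := by linarith
  have hg : 1 ≤ g := by
    have : (1 : ℝ) ≤ g := by linarith
    exact_mod_cast this
  have hpDq : ∀ q : ℝ, 0 ≤ q → (1 + e / 2) * q ≤ p * (D * q) := fun q hq => by
    rw [← mul_assoc]
    exact mul_le_mul_of_nonneg_right hpD hq
  have hgJ : 100 * ((J * g : ℕ) : ℝ) ≤ e * (J * Δ : ℕ) := by
    have := mul_le_mul_of_nonneg_left hgΔ (Nat.cast_nonneg J : (0 : ℝ) ≤ J)
    push_cast
    linarith
  have hΔJ : e * Δ ≤ e * (J * Δ : ℕ) := by gcongr; exact Nat.le_mul_of_pos_left Δ hJ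
  have hJe : e * (J * Δ : ℕ) ≤ (J * Δ : ℕ) := mul_le_of_le_one_left (Nat.cast_nonneg _) he1
  have hLK : 6 * ((J * g : ℕ) : ℝ) + 2 ≤ (J * Δ : ℕ) := by linarith
  have hnum : ∀ q : ℝ, Δ ≤ q → (1 + β) * q + κ < p * (D * q) := fun q hq => by
    have hq0 : 0 ≤ q := Δ.cast_nonneg.trans hq
    have heq := mul_le_mul_of_nonneg_left hq he0
    have hβq := mul_le_mul_of_nonneg_right hβe hq0
    linarith [hpDq q hq0]
  obtain ⟨m, hm, hlt⟩ := h.exists_mul_lt hexp hp.le hβ0 (Nat.mul_pos hJ hg) hLΔ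
    (by exact_mod_cast hLK) hJU hnum
  rw [div_lt_iff₀' hp]
  have hm' : e * (J * Δ : ℕ) ≤ e * (2 * m : ℕ) := by gcongr
  have hβm : β * m ≤ e / 8 * m := by gcongr
  have hβJ : β * (3 * (J * g : ℕ)) ≤ 1 / 8 * (3 * (J * g : ℕ)) := by gcongr; linarith
  push_cast at hm' hgJ hΔJ hβJ hlt
  linarith [hpDq m m.cast_nonneg]

lemma one_add_half_le_mul {ε p d : ℝ} (hε0 : 0 ≤ ε) (hε1 : ε ≤ 1 / 2) (he0 : 0 ≤ e)
    (hpd : 1 + 3 * ε / 4 ≤ p * d) : 1 + e / 2 ≤ p * ((1 - ε / 2 + e / 2) * d) :=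
  calc 1 + e / 2 ≤ (1 + 3 * ε / 4) * (1 - ε / 2 + e / 2) := by nlinarith
    _ ≤ p * d * (1 - ε / 2 + e / 2) := mul_le_mul_of_nonneg_right hpd (by linarith)
    _ = p * ((1 - ε / 2 + e / 2) * d) := by ring

variable [Fintype V] {k d : ℕ} {ε : ℝ}

theorem IsExpanderAt.exists_div_lt_card_longEdges (hG : IsExpanderAt G k d) (hk : 1 ≤ k)
    (hd : 2 ≤ d) (hkV : k ≤ Fintype.card V) (hε : 0 < ε) (hε1 : ε ≤ 1 / 2)
    (hκ : κ = ε ^ 2 * d * k / 10 ^ 7) (hκ10 : 10 ≤ κ) :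
    ∃ (U : Finset V) (g : ℕ), κ ≤ g ∧ ∀ (F : Finset (Sym2 V)) (p : ℝ), 0 < p →
      1 + 3 * ε / 4 ≤ p * d → IsTypical G F U p (ε / 64) κ →
      κ / p < (longEdges G F g).card := by
  obtain ⟨X, r, e, hXk, hr1, hrk, he8, he1, her, hexp⟩ :=
    hG.exists_reservoir hk (by omega) hε (by linarith)
  have he0 : 0 < e := by linarith
  have hκr : 122 * κ ≤ e ^ 2 * d * r / 640 := by
    have := mul_le_mul_of_nonneg_left her (d.cast_nonneg : (0 : ℝ) ≤ d)
    have : 0 ≤ ε ^ 2 * d * k := by positivity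
    linarith
  obtain ⟨J, Δ, g, hJ, hκg, hκΔ, hgΔ, hΔr, hrJ, hJr, hLΔ⟩ := exists_scales hd he0 he1 hκ10 hκr
  have hrobust : ExpandsRobustly G Xᶜ (J * Δ) Δ ((1 - ε / 2 + e / 2) * d) := by
    refine ExpandsOutside.expandsRobustly (δ := e / 2 * d) ?_ hr1 (by positivity)
      (hΔr.trans_eq (by ring)) hrJ hJr
    rwa [← add_mul, add_assoc, add_halves]
  have hΔdk : Δ ≤ d * k := by
    have hle : e * d * r ≤ 1 * d * k := by gcongr
    have : (Δ : ℝ) ≤ d * k := by linarith [show (0 : ℝ) ≤ d * k by positivity]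
    exact_mod_cast this
  have hJX : J * Δ ≤ Xᶜ.card := by
    have hn := hG.mul_add_le_card hkV
    have hkdk : k ≤ d * k := Nat.le_mul_of_pos_left k (by omega)
    have hJdk : J * Δ ≤ d * k := by
      rcases hJr with hJr | rfl
      · omega
      · rwa [one_mul]
    rw [Finset.card_compl]
    omega
  exact ⟨Xᶜ, g, hκg, fun F p hp hpd htyp =>
    htyp.div_lt_card_longEdges hrobust hp (by positivity) (by linarith) he1
      (one_add_half_le_mul hε.le hε1 he0.le hpd) hJ hκ10 hκg hκΔ hgΔ hLΔ hJX⟩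

end Parameters

section Cycles

variable {V : Type*} {G : SimpleGraph V}

lemma HasCycleOfLengthAtLeast.mono {a b : ℝ} (hab : a ≤ b) (h : HasCycleOfLengthAtLeast G b) :
    HasCycleOfLengthAtLeast G a := by
  obtain ⟨v, w, hw, hb⟩ := h
  exact ⟨v, w, hw, hab.trans hb⟩

lemma longEdges_subset [Fintype G.edgeSet] (F : Finset (Sym2 V)) (g : ℕ) :
    longEdges G F g ⊆ G.edgeFinset := by
  classical exact Finset.filter_subset _ _

lemma hasCycleOfLengthAtLeast_of_mem_longEdges [Fintype G.edgeSet] {F F' : Finset (Sym2 V)} {g : ℕ}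
    (hg : 2 ≤ g) {e : Sym2 V} (he : e ∈ longEdges G F g) (heF : e ∈ F') (hF : F ⊆ F') :
    HasCycleOfLengthAtLeast (fromEdgeSet (F' : Set (Sym2 V))) g := by
  simp only [longEdges, Finset.mem_filter, SimpleGraph.mem_edgeFinset] at he
  obtain ⟨heG, x, y, rfl, w, hw, hwg⟩ := he
  have hle : fromEdgeSet (F : Set (Sym2 V)) ≤ fromEdgeSet (F' : Set (Sym2 V)) :=
    SimpleGraph.fromEdgeSet_mono (Finset.coe_subset.2 hF)
  have hadj : (fromEdgeSet (F' : Set (Sym2 V))).Adj y x :=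
    (SimpleGraph.fromEdgeSet_adj _).2
      ⟨Sym2.eq_swap ▸ Finset.mem_coe.2 heF, ((SimpleGraph.mem_edgeSet G).1 heG).ne'⟩
  have hpath : (w.mapLe hle).IsPath := SimpleGraph.Walk.IsPath.mapLe hle hw
  have hlen : (w.mapLe hle).length = w.length := SimpleGraph.Walk.length_map _ _
  refine ⟨y, .cons hadj (w.mapLe hle), (SimpleGraph.Walk.cons_isCycle_iff _ _).2
    ⟨hpath, fun hmem => ?_⟩, ?_⟩
  · have := hpath.length_eq_one_of_mem_edges (Sym2.eq_swap ▸ hmem)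
    omega
  · rw [SimpleGraph.Walk.length_cons, hlen]
    exact_mod_cast hwg.trans (Nat.le_succ _)

lemma isTypical_edgeFinset [DecidableEq V] [Fintype G.edgeSet] (U : Finset V) {β η : ℝ}
    (hβ : 0 ≤ β) (hη : 0 < η) : IsTypical G G.edgeFinset U 1 β η := by
  rintro ⟨i, -, j, -, hbad⟩
  rw [Exploration.BadWindow, Exploration.positives_full_eq_queries] at hbad
  have : 0 ≤ β * (dfs G).queries G.edgeFinset ⟨[], U, ∅⟩ i j := by positivity
  linarith

lemma exists_card_filter_adj_le_one [Finite V] [DecidableRel G.Adj] (hG : G.IsAcyclic)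
    {W : Finset V} (hW : W.Nonempty) : ∃ v ∈ W, (W.filter (G.Adj v)).card ≤ 1 := by
  classical
  by_contra! hdeg
  obtain ⟨v, hv⟩ := hW
  have hpath : ∀ m : ℕ, ∃ (u : V) (w : G.Walk u v), w.IsPath ∧ u ∈ W ∧ w.length = m := by
    intro m
    induction m with
    | zero => exact ⟨v, .nil, .nil, hv, rfl⟩
    | succ m ih =>
      obtain ⟨u, w, hw, hu, hm⟩ := ih
      obtain ⟨x, hx, hxs⟩ := Finset.exists_mem_ne (hdeg u hu) w.snd
      obtain ⟨hxW, hux⟩ := Finset.mem_filter.1 hx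
      exact ⟨x, .cons hux.symm w, hw.cons fun h => hxs (hG.eq_snd_of_adj_start hw hux h), hxW,
        by rw [SimpleGraph.Walk.length_cons, hm]⟩
  have := Fintype.ofFinite V
  obtain ⟨u, w, hw, -, hm⟩ := hpath (Fintype.card V)
  exact hw.length_lt.ne hm

variable [Fintype V]

lemma exists_card_extNbhd_le (hG : G.IsAcyclic) {m : ℕ} (hm : m ≤ Fintype.card V) :
    ∃ S : Finset V, S.card = m ∧ (extNbhd G S).card ≤ m := by
  classical
  induction m with
  | zero => exact ⟨∅, rfl, by rw [extNbhd_empty, Finset.card_empty]⟩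
  | succ m ih =>
    obtain ⟨S, hS, hN⟩ := ih (by omega)
    have hne : Sᶜ.Nonempty := by
      rw [← Finset.card_pos, Finset.card_compl]
      omega
    obtain ⟨v, hv, hdeg⟩ := exists_card_filter_adj_le_one hG hne
    refine ⟨insert v S, by rw [Finset.card_insert_of_notMem (Finset.mem_compl.1 hv), hS], ?_⟩
    have hsub : extNbhd G (insert v S) ⊆ extNbhd G S ∪ Sᶜ.filter (G.Adj v) := fun x hx => by
      simp only [mem_extNbhd, Finset.mem_insert, not_or, Finset.mem_union, Finset.mem_filter,
        Finset.mem_compl] at hx ⊢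
      obtain ⟨⟨-, hxS⟩, u, rfl | hu, hux⟩ := hx
      · exact Or.inr ⟨hxS, hux⟩
      · exact Or.inl ⟨hxS, u, hu, hux⟩
    exact (Finset.card_le_card hsub).trans ((Finset.card_union_le _ _).trans (by omega))

variable {k d : ℕ} {ε : ℝ}

lemma IsExpanderAt.not_isAcyclic (hG : IsExpanderAt G k d) (hk : 1 ≤ k) (hd : 2 ≤ d)
    (hkV : k ≤ Fintype.card V) : ¬ G.IsAcyclic := fun hacyc => by
  obtain ⟨S, hS, hN⟩ := exists_card_extNbhd_le hacyc hkV
  have hdk : 2 * k ≤ d * S.card := hS.symm ▸ Nat.mul_le_mul_right k hd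
  have := hG S hS
  omega

theorem IsExpanderAt.hasCycleOfLengthAtLeast (hG : IsExpanderAt G k d) (hk : 1 ≤ k) (hd : 2 ≤ d)
    (hkV : k ≤ Fintype.card V) (hε : 0 < ε) (hε1 : ε ≤ 1 / 2) :
    HasCycleOfLengthAtLeast G (ε ^ 2 * d * k / 10 ^ 7 / 5) := by
  classical
  set κ := ε ^ 2 * d * k / 10 ^ 7 with hκ
  rcases lt_or_ge κ 10 with hκ10 | hκ10
  · obtain ⟨v, w, hw⟩ : ∃ (v : V) (w : G.Walk v v), w.IsCycle := by
      by_contra! hno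
      exact hG.not_isAcyclic hk hd hkV fun v w => hno v w
    have hlen : (3 : ℝ) ≤ w.length := by exact_mod_cast hw.three_le_length
    exact ⟨v, w, hw, by linarith⟩
  · obtain ⟨U, g, hκg, hlong⟩ :=
      hG.exists_div_lt_card_longEdges hk hd hkV hε hε1 hκ hκ10
    have hd2 : (2 : ℝ) ≤ d := by exact_mod_cast hd
    have hlt := hlong G.edgeFinset 1 one_pos (by linarith)
      (isTypical_edgeFinset U (by positivity) (by linarith))
    have hpos : 0 < (longEdges G G.edgeFinset g).card := by
      exact_mod_cast (show 0 ≤ κ / 1 by positivity).trans_lt hlt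
    obtain ⟨e, he⟩ := Finset.card_pos.1 hpos
    have hg : 2 ≤ g := by exact_mod_cast (by linarith : (2 : ℝ) ≤ g)
    have hcyc := hasCycleOfLengthAtLeast_of_mem_longEdges hg he (longEdges_subset _ _ he) subset_rfl
    rw [SimpleGraph.coe_edgeFinset, SimpleGraph.fromEdgeSet_edgeSet] at hcyc
    exact hcyc.mono (by linarith)

end Cycles

section Sprinkling

lemma exists_sprinkling {p p₁ : ℝ} (hp₁ : 0 ≤ p₁) (hlt : p₁ < p) (hp : p ≤ 1) :
    ∃ p₂, p - p₁ ≤ p₂ ∧ p₂ ≤ 1 ∧ 1 - p = (1 - p₁) * (1 - p₂) := by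
  have hpos : 0 < 1 - p₁ := by linarith
  refine ⟨(p - p₁) / (1 - p₁), ?_, ?_, ?_⟩
  · exact le_div_self (by linarith) hpos (by linarith)
  · rw [div_le_one hpos]
    linarith
  · field_simp
    ring

variable {α : Type*} [DecidableEq α] {E : Finset α} {p p₁ p₂ : ℝ}

omit [DecidableEq α] in
lemma prob_disjoint_le_exp {L : Finset α} (hL : L ⊆ E) (hp1 : p ≤ 1) :
    prob E p (fun F => Disjoint F L) ≤ Real.exp (-(p * L.card)) :=
  calc prob E p (fun F => Disjoint F L) = (1 - p) ^ L.card := prob_disjoint hL p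
    _ ≤ Real.exp (-p) ^ L.card :=
      pow_le_pow_left₀ (sub_nonneg.2 hp1) (Real.one_sub_le_exp_neg p) _
    _ = Real.exp (-(p * L.card)) := by
      rw [← Real.exp_nat_mul]
      ring_nf

/-- Two-round exposure: unless the first round lands in `B`, it provides a large set of which the
second round need only hit one element. -/
lemma one_sub_le_prob_of_sprinkling (hp₁0 : 0 ≤ p₁) (hp₁1 : p₁ ≤ 1) (hp₂0 : 0 ≤ p₂) (hp₂1 : p₂ ≤ 1)
    (hp : 1 - p = (1 - p₁) * (1 - p₂)) {A B : Finset α → Prop} {a : ℝ}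
    (h : ∀ F₁, ¬ B F₁ → ∃ L ⊆ E, a ≤ p₂ * L.card ∧
      ∀ F₂, ¬ Disjoint F₂ L → A (F₁ ∪ F₂)) :
    1 - (prob E p₁ B + Real.exp (-a)) ≤ prob E p A := by
  classical
  have hinner : ∀ F₁ ⊆ E, prob E p₂ (fun F₂ => ¬ A (F₁ ∪ F₂)) ≤
      (if B F₁ then 1 else 0) + Real.exp (-a) := by
    intro F₁ _
    split_ifs with hB
    · exact (prob_le_one hp₂0 hp₂1 _).trans (le_add_of_nonneg_right (Real.exp_pos _).le)
    · obtain ⟨L, hL, ha, hA⟩ := h F₁ hB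
      rw [zero_add]
      calc prob E p₂ (fun F₂ => ¬ A (F₁ ∪ F₂))
          ≤ prob E p₂ fun F₂ => Disjoint F₂ L :=
            prob_mono hp₂0 hp₂1 fun F₂ _ => not_imp_comm.1 (hA F₂)
        _ ≤ Real.exp (-(p₂ * L.card)) := prob_disjoint_le_exp hL hp₂1
        _ ≤ Real.exp (-a) := Real.exp_le_exp.2 (neg_le_neg ha)
  have houter : prob E p (fun F => ¬ A F) ≤ prob E p₁ B + Real.exp (-a) :=
    calc prob E p (fun F => ¬ A F)
        = expect E p₁ fun F₁ => prob E p₂ fun F₂ => ¬ A (F₁ ∪ F₂) := expect_union E hp _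
      _ ≤ expect E p₁ fun F₁ => (if B F₁ then 1 else 0) + Real.exp (-a) :=
        expect_mono hp₁0 hp₁1 hinner
      _ = prob E p₁ B + Real.exp (-a) := by
        rw [expect_add, expect_const]
        rfl
  rw [prob_not] at houter
  linarith

variable {V : Type*} [Fintype V] {G : SimpleGraph V} {k d : ℕ} {ε κ : ℝ}

lemma prob_not_isTypical_le [DecidableEq V] [Fintype G.edgeSet] (U : Finset V) {β : ℝ} (hp0 : 0 ≤ p)
    (hp1 : p ≤ 1) (hβ0 : 0 ≤ β) (hβ1 : β ≤ 1 / 2) (η : ℝ) :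
    prob G.edgeFinset p (fun F => ¬ IsTypical G F U p β η) ≤
      ((Fintype.card V : ℝ) + 1) ^ 4 * Real.exp (-(β * η)) := by
  simp only [IsTypical, not_not]
  refine ((dfs G).prob_exists_badWindow_le hp0 hp1 hβ0 hβ1 η _ _).trans ?_
  refine mul_le_mul_of_nonneg_right ?_ (Real.exp_pos _).le
  have hU : U.card ≤ Fintype.card V := Finset.card_le_univ U
  have hE : G.edgeFinset.card ≤ Fintype.card V ^ 2 :=
    SimpleGraph.card_edgeFinset_le_card_choose_two.trans (Nat.choose_le_pow _ _)
  have hN : 2 * U.card + G.edgeFinset.card + 1 ≤ (Fintype.card V + 1) ^ 2 := by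
    rw [add_sq]
    omega
  rw [show 4 = 2 * 2 from rfl, pow_mul]
  gcongr
  exact_mod_cast hN

theorem IsExpanderAt.one_sub_le_randomSubgraph (hG : IsExpanderAt G k d) (hk : 1 ≤ k) (hd : 2 ≤ d)
    (hkV : k ≤ Fintype.card V) (hε : 0 < ε) (hε1 : ε ≤ 1 / 2)
    (hκ : κ = ε ^ 2 * d * k / 10 ^ 7) (hκ10 : 10 ≤ κ) {p : I} (hp : (1 + ε) / d ≤ p) :
    1 - (((Fintype.card V : ℝ) + 1) ^ 4 + 1) * Real.exp (-(ε / 64 * κ)) ≤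
      (randomSubgraph G p).real {H | HasCycleOfLengthAtLeast H κ} := by
  classical
  have hd0 : (0 : ℝ) < d := by positivity
  obtain ⟨p₁, hp₁⟩ : ∃ p₁ : ℝ, p₁ = (1 + 3 * ε / 4) / d := ⟨_, rfl⟩
  have hp₁0 : 0 < p₁ := hp₁ ▸ by positivity
  have hgap : ε / 4 / d ≤ p - p₁ := by
    have : (1 + ε) / d - p₁ = ε / 4 / d := by rw [hp₁]; ring
    linarith
  have hlt : p₁ < p := by linarith [show 0 < ε / 4 / d by positivity]
  obtain ⟨p₂, hgap₂, hp₂1, hp₁₂⟩ := exists_sprinkling hp₁0.le hlt p.2.2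
  have hratio : ε / 64 * p₁ ≤ p₂ := by
    refine le_trans ?_ (hgap.trans hgap₂)
    rw [hp₁, mul_div_assoc', div_le_div_iff_of_pos_right hd0]
    nlinarith
  obtain ⟨U, g, hκg, hlong⟩ := hG.exists_div_lt_card_longEdges hk hd hkV hε hε1 hκ hκ10
  have hg : 2 ≤ g := by exact_mod_cast (by linarith : (2 : ℝ) ≤ g)
  have hsprinkle := one_sub_le_prob_of_sprinkling (E := G.edgeFinset) (a := ε / 64 * κ)
    (A := fun F => HasCycleOfLengthAtLeast (fromEdgeSet (F : Set (Sym2 V))) κ)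
    (B := fun F => ¬ IsTypical G F U p₁ (ε / 64) κ) hp₁0.le (hlt.le.trans p.2.2)
    (by linarith) hp₂1 hp₁₂ fun F₁ htyp => by
      have hmany := hlong F₁ p₁ hp₁0 (by rw [hp₁, div_mul_cancel₀ _ hd0.ne']) (not_not.1 htyp)
      refine ⟨longEdges G F₁ g, longEdges_subset _ _, ?_, fun F₂ hhit => ?_⟩
      · rw [div_lt_iff₀' hp₁0] at hmany
        calc ε / 64 * κ ≤ ε / 64 * (p₁ * (longEdges G F₁ g).card) := by gcongr
          _ = ε / 64 * p₁ * (longEdges G F₁ g).card := by ring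
          _ ≤ p₂ * (longEdges G F₁ g).card := by gcongr
      · obtain ⟨e, heF, heL⟩ := Finset.not_disjoint_iff.1 hhit
        exact (hasCycleOfLengthAtLeast_of_mem_longEdges hg heL (Finset.mem_union_right _ heF)
          Finset.subset_union_left).mono hκg
  have htypical := prob_not_isTypical_le (G := G) U hp₁0.le (hlt.le.trans p.2.2)
    (by positivity : 0 ≤ ε / 64) (by linarith) κ
  rw [randomSubgraph_real_eq_prob]
  refine le_trans ?_ hsprinkle
  linarith

open Filter in
lemma eventually_add_one_pow_four_mul_exp_le {θ : ℝ} (hθ : 0 < θ) :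
    ∀ᶠ n : ℕ in atTop,
      (((n : ℝ) + 1) ^ 4 + 1) * Real.exp (-(θ * n)) ≤ Real.exp (-(θ / 2 * n)) := by
  have hlim : Tendsto (fun x : ℝ => x ^ 4 * Real.exp (-(θ / 2) * x)) atTop (nhds 0) :=
    (tendsto_rpow_mul_exp_neg_mul_atTop_nhds_zero 4 (θ / 2) (by positivity)).congr
      fun x => by norm_cast
  have hsmall := (hlim.comp tendsto_natCast_atTop_atTop).eventually
    (eventually_le_nhds (by norm_num : (0 : ℝ) < 1 / 17))
  filter_upwards [hsmall, eventually_ge_atTop 1] with n hn hn1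
  have hn1' : (1 : ℝ) ≤ n := by exact_mod_cast hn1
  have hpoly : ((n : ℝ) + 1) ^ 4 + 1 ≤ 17 * n ^ 4 := by
    have hle : ((n : ℝ) + 1) ^ 4 ≤ (2 * n) ^ 4 := by gcongr; linarith
    have hone : (1 : ℝ) ≤ n ^ 4 := one_le_pow₀ hn1'
    linarith [mul_pow 2 (n : ℝ) 4]
  have hexp : Real.exp (-(θ * n)) = Real.exp (-(θ / 2) * n) * Real.exp (-(θ / 2 * n)) := by
    rw [← Real.exp_add]
    ring_nf
  rw [hexp, ← mul_assoc]
  refine mul_le_of_le_one_left (Real.exp_pos _).le ?_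
  calc (((n : ℝ) + 1) ^ 4 + 1) * Real.exp (-(θ / 2) * n)
      ≤ 17 * n ^ 4 * Real.exp (-(θ / 2) * n) := by gcongr
    _ = 17 * (n ^ 4 * Real.exp (-(θ / 2) * n)) := by ring
    _ ≤ 1 := by
      have : (n : ℝ) ^ 4 * Real.exp (-(θ / 2) * n) ≤ 1 / 17 := hn
      linarith

end Sprinkling

section Main

variable {V : Type*} {G : SimpleGraph V} {k d : ℕ} {ε : ℝ} {p : I}

lemma randomSubgraph_real_mono [Finite V] {a b : ℝ} (hab : a ≤ b) :
    (randomSubgraph G p).real {H | HasCycleOfLengthAtLeast H b} ≤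
      (randomSubgraph G p).real {H | HasCycleOfLengthAtLeast H a} := by
  classical
  have := Fintype.ofFinite V
  rw [randomSubgraph_real_eq_prob, randomSubgraph_real_eq_prob]
  exact prob_mono p.2.1 p.2.2 fun _ _ h => h.mono hab

variable [Fintype V]

lemma IsExpanderAt.pow_sq_le_randomSubgraph (hG : IsExpanderAt G k d) (hk : 1 ≤ k) (hd : 2 ≤ d)
    (hkV : k ≤ Fintype.card V) (hε : 0 < ε) (hε1 : ε ≤ 1 / 2) (hp : (1 + ε) / d ≤ p) {m : ℕ}
    (hm : Fintype.card V ≤ m) :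
    (1 / (m : ℝ)) ^ m ^ 2 ≤
      (randomSubgraph G p).real {H | HasCycleOfLengthAtLeast H (ε ^ 2 * d * k / 10 ^ 7 / 5)} := by
  classical
  have hdm : d ≤ m := by
    have hdk : d ≤ d * k := Nat.le_mul_of_pos_right d hk
    have := hG.mul_add_le_card hkV
    omega
  have hpm : 1 / (m : ℝ) ≤ p := by
    refine le_trans ?_ hp
    gcongr
    linarith
  have hE : G.edgeFinset.card ≤ m ^ 2 :=
    (SimpleGraph.card_edgeFinset_le_card_choose_two.trans (Nat.choose_le_pow _ _)).trans
      (Nat.pow_le_pow_left hm 2)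
  rw [randomSubgraph_real_eq_prob]
  calc (1 / (m : ℝ)) ^ m ^ 2 ≤ (p : ℝ) ^ m ^ 2 := by gcongr
    _ ≤ (p : ℝ) ^ G.edgeFinset.card := pow_le_pow_of_le_one p.2.1 p.2.2 hE
    _ ≤ _ := pow_card_le_prob p.2.1 p.2.2 (by
      rw [SimpleGraph.coe_edgeFinset, SimpleGraph.fromEdgeSet_edgeSet]
      exact hG.hasCycleOfLengthAtLeast hk hd hkV hε hε1)

lemma IsExpanderAt.one_sub_exp_le_randomSubgraph_of_card_le (hG : IsExpanderAt G k d) (hk : 1 ≤ k)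
    (hd : 2 ≤ d) (hkV : k ≤ Fintype.card V) (hε : 0 < ε) (hε1 : ε ≤ 1 / 2) (hp : (1 + ε) / d ≤ p)
    {m : ℕ} (hm0 : 0 < m) (hm : Fintype.card V ≤ m) :
    1 - Real.exp (-((1 / (m : ℝ)) ^ m ^ 2 / m * Fintype.card V)) ≤
      (randomSubgraph G p).real {H | HasCycleOfLengthAtLeast H (ε ^ 2 * d * k / 10 ^ 7 / 5)} := by
  refine le_trans ?_ (hG.pow_sq_le_randomSubgraph hk hd hkV hε hε1 hp hm)
  obtain ⟨δ, hδ⟩ : ∃ δ, δ = (1 / (m : ℝ)) ^ m ^ 2 := ⟨_, rfl⟩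
  rw [← hδ, sub_le_comm]
  calc 1 - δ = 1 - δ / m * m := by rw [div_mul_cancel₀ _ (by positivity)]
    _ ≤ 1 - δ / m * Fintype.card V := by
      have : 0 ≤ δ := hδ ▸ by positivity
      gcongr
    _ ≤ Real.exp (-(δ / m * Fintype.card V)) := Real.one_sub_le_exp_neg _

lemma IsExpanderAt.one_sub_exp_le_randomSubgraph_of_le_card (hG : IsExpanderAt G k d) (hk : 1 ≤ k)
    (hd : 2 ≤ d) (hkV : k ≤ Fintype.card V) (hε : 0 < ε) (hε1 : ε ≤ 1 / 2) (hp : (1 + ε) / d ≤ p)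
    {a : ℝ} (ha : a * Fintype.card V ≤ ε ^ 2 * d * k / 10 ^ 7) (ha10 : 10 ≤ a * Fintype.card V)
    (hpoly : ((Fintype.card V + 1 : ℝ) ^ 4 + 1) * Real.exp (-(ε / 64 * a * Fintype.card V)) ≤
      Real.exp (-(ε / 64 * a / 2 * Fintype.card V))) :
    1 - Real.exp (-(ε / 64 * a / 2 * Fintype.card V)) ≤
      (randomSubgraph G p).real {H | HasCycleOfLengthAtLeast H (ε ^ 2 * d * k / 10 ^ 7 / 5)} := by
  obtain ⟨κ, hκ⟩ : ∃ κ, κ = ε ^ 2 * d * k / 10 ^ 7 := ⟨_, rfl⟩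
  rw [← hκ] at ha ⊢
  have haκ : ε / 64 * a * Fintype.card V ≤ ε / 64 * κ := by
    rw [mul_assoc]
    gcongr
  calc 1 - Real.exp (-(ε / 64 * a / 2 * Fintype.card V))
      ≤ 1 - ((Fintype.card V + 1 : ℝ) ^ 4 + 1) * Real.exp (-(ε / 64 * a * Fintype.card V)) := by
        gcongr
    _ ≤ 1 - ((Fintype.card V + 1 : ℝ) ^ 4 + 1) * Real.exp (-(ε / 64 * κ)) := by gcongr
    _ ≤ (randomSubgraph G p).real {H | HasCycleOfLengthAtLeast H κ} :=
      hG.one_sub_le_randomSubgraph hk hd hkV hε hε1 hκ (ha10.trans ha) hp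
    _ ≤ (randomSubgraph G p).real {H | HasCycleOfLengthAtLeast H (κ / 5)} :=
      randomSubgraph_real_mono (by linarith)

theorem exists_one_sub_exp_le_randomSubgraph {c : ℝ} (hc : 0 < c) (hε : 0 < ε) (hε1 : ε ≤ 1 / 2) :
    ∃ γ : ℝ, 0 < γ ∧ ∀ (V : Type*) [Fintype V] (G : SimpleGraph V) (d k : ℕ) (p : I),
      1 ≤ k → 2 ≤ d → k ≤ Fintype.card V → c * Fintype.card V ≤ d * k → IsExpanderAt G k d →
      (1 + ε) / d ≤ p →
      1 - Real.exp (-(γ * Fintype.card V)) ≤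
        (randomSubgraph G p).real
          {H | HasCycleOfLengthAtLeast H (ε ^ 2 * d * k / 10 ^ 7 / 5)} := by
  obtain ⟨a, ha⟩ : ∃ a, a = ε ^ 2 * c / 10 ^ 7 := ⟨_, rfl⟩
  have ha0 : 0 < a := ha ▸ by positivity
  obtain ⟨m, hm⟩ := Filter.eventually_atTop.1 <|
    (eventually_add_one_pow_four_mul_exp_le (by positivity : 0 < ε / 64 * a)).and <|
      (tendsto_natCast_atTop_atTop.eventually_ge_atTop (10 / a)).and (Filter.eventually_gt_atTop 0)
  have hm0 : 0 < m := (hm m le_rfl).2.2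
  refine ⟨min (ε / 64 * a / 2) ((1 / (m : ℝ)) ^ m ^ 2 / m), by positivity,
    fun V _ G d k p hk hd hkV hck hG hp => ?_⟩
  rcases le_total (Fintype.card V) m with hn | hn
  · refine le_trans ?_ (hG.one_sub_exp_le_randomSubgraph_of_card_le hk hd hkV hε hε1 hp hm0 hn)
    gcongr
    exact min_le_right _ _
  · obtain ⟨hpoly, han, -⟩ := hm _ hn
    have haκ : a * Fintype.card V ≤ ε ^ 2 * d * k / 10 ^ 7 := by
      rw [ha]
      linarith [mul_le_mul_of_nonneg_left hck (sq_nonneg ε)]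
    refine le_trans ?_ (hG.one_sub_exp_le_randomSubgraph_of_le_card hk hd hkV hε hε1 hp haκ
      ((div_le_iff₀' ha0).1 han) hpoly)
    gcongr
    exact min_le_left _ _

end Main

section Rounding

variable {c ε : ℝ} {n d k : ℕ}

lemma two_le_of_one_add_div_le_one (hd : 1 ≤ d) (hε : 0 < ε) (h : (1 + ε) / d ≤ 1) : 2 ≤ d := by
  have hd0 : (0 : ℝ) < d := by exact_mod_cast hd
  rw [div_le_one hd0] at h
  have : (1 : ℝ) < d := by linarith
  exact_mod_cast this

lemma le_of_abs_sub_div_lt_one (hc : c < 1) (hd : 2 ≤ d) (hk : 1 ≤ k)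
    (h : |(k : ℝ) - c * n / d| < 1) : k ≤ n := by
  have hd2 : (2 : ℝ) ≤ d := by exact_mod_cast hd
  have hround : c * n / d ≤ n / 2 := by
    gcongr
    exact mul_le_of_le_one_left n.cast_nonneg hc.le
  have hlt : (k : ℝ) < n / 2 + 1 := by linarith [(abs_lt.1 h).2]
  have hlt' : 2 * k < n + 2 := by
    have : 2 * (k : ℝ) < n + 2 := by linarith
    exact_mod_cast this
  omega

lemma half_mul_le_of_div_lt_add_one (hd : 1 ≤ d) (hk : 1 ≤ k) (h : c * n / d < k + 1) :
    c / 2 * n ≤ d * k := by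
  have hk1 : (1 : ℝ) ≤ k := by exact_mod_cast hk
  have hd0 : (0 : ℝ) < d := by exact_mod_cast hd
  have hlt : c * n / d < 2 * k := by linarith
  rw [div_lt_iff₀ hd0] at hlt
  linarith

end Rounding

end Percolation

open Percolation in
theorem theorem1p3_general :
    ∃ C : ℝ, 0 < C ∧ ∀ c ε : ℝ, 0 < c → 0 < ε → ε ≤ 1 / 2 →
      ∃ γ : ℝ, 0 < γ ∧ ∀ (V : Type*) [Fintype V] (G : SimpleGraph V) (d k : ℕ) (p : I),
        2 ≤ d → 1 ≤ k → k ≤ Fintype.card V → c * Fintype.card V / d < k + 1 →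
        IsExpanderAt G k d → (1 + ε) / d ≤ p →
        1 - Real.exp (-(γ * Fintype.card V)) ≤
          (randomSubgraph G p).real
            {H | HasCycleOfLengthAtLeast H (C * ε ^ 2 * c * Fintype.card V)} := by
  refine ⟨1 / 10 ^ 8, by norm_num, fun c ε hc hε hε1 => ?_⟩
  obtain ⟨γ, hγ, hcycle⟩ := exists_one_sub_exp_le_randomSubgraph (half_pos hc) hε hε1
  refine ⟨γ, hγ, fun V _ G d k p hd hk hkV hround hG hp => ?_⟩
  have hdk : c / 2 * Fintype.card V ≤ d * k :=
    half_mul_le_of_div_lt_add_one (one_le_two.trans hd) hk hround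
  refine (hcycle V G d k p hk hd hkV hdk hG hp).trans (randomSubgraph_real_mono ?_)
  calc 1 / 10 ^ 8 * ε ^ 2 * c * Fintype.card V
      = ε ^ 2 * (c / 2 * Fintype.card V) / 10 ^ 7 / 5 := by ring
    _ ≤ ε ^ 2 * (d * k) / 10 ^ 7 / 5 := by gcongr
    _ = ε ^ 2 * d * k / 10 ^ 7 / 5 := by ring

theorem theorem1p3 :
    ∃ C : ℝ, 0 < C ∧
      ∀ c : ℝ, 0 < c → c < 1 →
        ∃ ε₀ : ℝ, 0 < ε₀ ∧
          ∀ ε : ℝ, 0 < ε → ε ≤ ε₀ →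
            ∃ γ : ℝ, 0 < γ ∧
              ∀ (V : Type*) [Fintype V] (G : SimpleGraph V) (d k : ℕ) (p : unitInterval),
                1 ≤ d →
                -- `k` is `c n / d`, rounded up or down to a positive integer
                1 ≤ k → |(k : ℝ) - c * (Fintype.card V : ℝ) / (d : ℝ)| < 1 →
                Percolation.IsExpanderAt G k d →
                (p : ℝ) = (1 + ε) / (d : ℝ) →
                1 - Real.exp (-(γ * (Fintype.card V : ℝ))) ≤
                  (Percolation.randomSubgraph G p).real
                    {H | Percolation.HasCycleOfLengthAtLeast H
                      (C * ε ^ 2 * c ^ 2 * (Fintype.card V : ℝ))} := by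
  open Percolation in
  obtain ⟨C, hC, hgeneral⟩ := theorem1p3_general
  refine ⟨C, hC, fun c hc0 hc1 => ⟨1 / 2, by norm_num, fun ε hε hε1 => ?_⟩⟩
  obtain ⟨γ, hγ, hcycle⟩ := hgeneral c ε hc0 hε hε1
  refine ⟨γ, hγ, fun V _ G d k p hd1 hk hround hG hp => ?_⟩
  have hd : 2 ≤ d := two_le_of_one_add_div_le_one hd1 hε (hp ▸ p.2.2)
  have hkV : k ≤ Fintype.card V := le_of_abs_sub_div_lt_one hc1 hd hk hround
  have hupper : c * Fintype.card V / d < k + 1 := by linarith [(abs_lt.1 hround).1]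
  refine (hcycle V G d k p hd hk hkV hupper hG hp.ge).trans (randomSubgraph_real_mono ?_)
  gcongr
  exact pow_le_of_le_one hc0.le hc1.le two_ne_zero
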